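/- Let $A\in\mathbb{R}^{n\times n}$ be symmetric, $h\in\mathbb{R}^n$, and let $\pi(x)\propto\exp(\frac12x^{T}Ax+h^{T}x)$ be the Ising model on $\{-1,1\}^n$. Write $i\sim j$ if $i\neq j$ and $A_{ij}\neq0$; $x^{i\mapsto a}$ for $x$ with the $i$-th spin set to $a$; $x^{\oplus i}$ for $x$ with the $i$-th spin flipped. Let $d\ge 1$ be an integer and $\lambda,\alpha>0$. Assume that each site has at most $d$ neighbours, that $\sum_{k\ne i}|A_{ik}|+|h_i|\le\lambda$ for all $i$, and that $|A_{ij}|\ge\alpha$ whenever $i\sim j$. Let $\mathsf P_i$ ($i\in[n]$) be transition kernels on $\{-1,1\}^n$, where $\mathsf P_i$ changes at most the spin at $i$, such that for all $i$: (1) (reversibility) $\pi(x)\mathsf P_i(x,x^{\oplus i})=\mathsf P_i(x^{\oplus i},x)\pi(x^{\oplus i})$ for all $x$; (2) (site-consistency) $\mathsf P_i(x^{i\mapsto-1},x^{i\mapsto+1})=f_i(r_i(x))$ for all $x$, where $r_i(x)=\pi(x^{i\mapsto+1})/\pi(x^{i\mapsto-1})$ and $f_i:(0,\infty)\to[0,1]$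 is nondecreasing; put $g_i(z)=f_i(z)^2/z$; (3) ($(\lambda,\alpha,\delta_0,\eta)$-stability) $\alpha\le\lambda$, the function $\eta:[0,1]\to[0,\infty)$ is nondecreasing with $\eta(0)=0$, and for each $a\ge\alpha$ there is a unique $z^*>0$ with $g_i(z^*)=g_i(e^{a}z^*)$; moreover, if $0\le\delta\le\min(\delta_0,1)$ and $z\in[e^{-2\lambda},e^{2\lambda}]$ satisfy $|g_i(z)-g_i(e^{a}z)|\le\delta$, then $|z^*-z|\le\eta(\delta)$; (4) ($\gamma$-boundedness, $\gamma\ge0$) $\mathsf P_i(x,x^{i\mapsto\sigma})\le\exp\bigl(\gamma\sum_{k:x_k\ne y_k}|A_{ik}|\bigr)\,\mathsf P_i(y,y^{i\mapsto\sigma})$ for all $x,y$ with $x_i=y_i$ and all $\sigma\in\{\pm1\}$; (5) $\mathsf P_i(x,x^{\oplus i})\ge\kappa$ for all $x$, where $\kappa>0$. Let $(X^t)_{t\ge0}$ be the continuous-time Markov chain in which every $\mathsf P_i$ is applied at the times of an independent Poisson clock of rate $1$, i.e. the right-continuous Markov chain with generator $\sum_i(\mathsf P_i-I)$, started from any initial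 law. Let $\Pi'_i$ be the set of times at which the spin at $i$ flips, and $\mathcal F_t=\sigma(X^0,\Pi_1'\cap[0,t],\dots,\Pi_n'\cap[0,t])$. For sites $i\ne j$, $\varepsilon>0$, $t\ge0$ and $\ell\in\{i,j\}^m$, let $\mathcal E^t_\ell$ be the event that for each $k=1,\dots,m$, during $[t+(k-1)\varepsilon,t+k\varepsilon]$, site $\ell_k$ flips exactly once and the other site of $\{i,j\}$ does not flip. Put $$Z^{i,j}_t=\mathbf 1\{\mathcal E^t_{iijjiijj}\}-2\cdot\mathbf 1\{\mathcal E^t_{iijjjiij}\}+\mathbf 1\{\mathcal E^t_{jiijjiij}\}.$$ Then there are absolute constants $c,C>0$ such that the following hold (almost surely) for all such data and all $i\ne j$, $\varepsilon>0$. (a) If $\varepsilon<c$ and $t\ge0$, then $$\Bigl|\mathbb E[Z^{i,j}_t\mid\mathcal F_t]-\varepsilon^8 g_j\bigl(r_j(X^t)\bigr)^2\Bigl(g_i\bigl(r_i(X^t)\bigr)-g_i\bigl(r_i(X^{t,\oplus j})\bigr)\Bigr)^2\Bigr|\le C\,d\,\varepsilon^9 .$$ (b) If $i\not\sim j$, $\varepsilon<c$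 and $0\le t'\le t$, then $\bigl|\mathbb E[Z^{i,j}_t\mid\mathcal F_{t'}]\bigr|\le C\,d\,\varepsilon^9$. (c) Suppose $i\sim j$ and $i\sim k$ for some $k\ne j$. Let $0<\delta\le\min(\delta_0,1)$ be such that $\eta(\delta)\le c\,\alpha\,e^{-C\lambda}$. If $\varepsilon<c\,\kappa^8\delta^2e^{-C\gamma\lambda}/d$ and $t,t'\ge0$ satisfy $t'\le t-1$, then $$\mathbb E[Z^{i,j}_t\mid\mathcal F_{t'}]\ge c\,\varepsilon^8\kappa^8\delta^2e^{-C\gamma\lambda}.$$ -/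

import Mathlib

open MeasureTheory Filter Topology
open scoped NNReal

namespace FlipCycle

noncomputable section

/-! ### Configurations and Ising models -/

/-- Spin configurations `{-1, 1}ⁿ`; the group `ℤˣ` is the two-point set `{1, -1}`. -/
abbrev Config (n : ℕ) : Type := Fin n → ℤˣ

/-- The real value `x_i ∈ {-1, 1}` of the spin at site `i`. -/
def spin {n : ℕ} (x : Config n) (i : Fin n) : ℝ := ((x i : ℤ) : ℝ)

/-- `x^{i ↦ a}`: the configuration `x` with the spin at `i` reset to `a`. -/
def setSpin {n : ℕ} (x : Config n) (i : Fin n) (a : ℤˣ) : Config n := Function.update x i a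

/-- `x^{⊕ i}`: the configuration `x` with the spin at `i` flipped. -/
def flipAt {n : ℕ} (x : Config n) (i : Fin n) : Config n := setSpin x i (-x i)

/-- The unnormalized weight `exp(½ xᵀ A x + hᵀ x)`. -/
def weight {n : ℕ} (A : Matrix (Fin n) (Fin n) ℝ) (h : Fin n → ℝ) (x : Config n) : ℝ :=
  Real.exp ((1 / 2) * (∑ i, ∑ j, spin x i * A i j * spin x j) + ∑ i, h i * spin x i)

/-- The Ising model `π_{A,h}` on `{-1, 1}ⁿ`. -/
def ising {n : ℕ} (A : Matrix (Fin n) (Fin n) ℝ) (h : Fin n → ℝ) (x : Config n) : ℝ :=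
  weight A h x / ∑ y, weight A h y

/-- Adjacency `i ∼ j` in the dependence graph. -/
def Adj {n : ℕ} (A : Matrix (Fin n) (Fin n) ℝ) (i j : Fin n) : Prop := i ≠ j ∧ A i j ≠ 0

/-- The nondegeneracy assumptions on the Ising model: symmetric interactions, at most `d`
neighbours per site, width at most `lam`, and interactions of neighbours at least `α`. -/
structure IsingAssumption {n : ℕ} (A : Matrix (Fin n) (Fin n) ℝ) (h : Fin n → ℝ)
    (d : ℕ) (lam α : ℝ) : Prop where
  symm : A.IsSymm
  d_pos : 0 < d
  lam_pos : 0 < lam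
  α_pos : 0 < α
  degree : ∀ i, {j | Adj A i j}.ncard ≤ d
  width : ∀ i, (∑ k ∈ Finset.univ.erase i, |A i k|) + |h i| ≤ lam
  nondegenerate : ∀ i j, Adj A i j → α ≤ |A i j|

/-! ### Single-site transition kernels -/

/-- `P i` is, for each site `i`, a transition matrix on configurations that changes
no spin other than that of `i`. -/
structure IsSingleSite {n : ℕ} (P : Fin n → Matrix (Config n) (Config n) ℝ) : Prop where
  nonneg : ∀ i x y, 0 ≤ P i x y
  sum_eq_one : ∀ i x, ∑ y, P i x y = 1
  support : ∀ i x y, y ≠ x → y ≠ flipAt x i → P i x y = 0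

/-- Detailed balance of every site kernel with respect to `π`. -/
def IsReversible {n : ℕ} (π : Config n → ℝ)
    (P : Fin n → Matrix (Config n) (Config n) ℝ) : Prop :=
  ∀ i x, π x * P i x (flipAt x i) = P i (flipAt x i) x * π (flipAt x i)

/-- The probability ratio `π(x^{i ↦ +1}) / π(x^{i ↦ -1})`. -/
def ratio {n : ℕ} (π : Config n → ℝ) (i : Fin n) (x : Config n) : ℝ :=
  π (setSpin x i 1) / π (setSpin x i (-1))

/-- Site-consistency, witnessed by the functions `f i : (0, ∞) → [0, 1]`
(the values of `f i` outside `(0, ∞)` are irrelevant). -/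
structure IsSiteConsistent {n : ℕ} (π : Config n → ℝ)
    (P : Fin n → Matrix (Config n) (Config n) ℝ) (f : Fin n → ℝ → ℝ) : Prop where
  mapsTo : ∀ i, Set.MapsTo (f i) (Set.Ioi 0) (Set.Icc 0 1)
  mono : ∀ i, MonotoneOn (f i) (Set.Ioi 0)
  eq : ∀ i x, P i (setSpin x i (-1)) (setSpin x i 1) = f i (ratio π i x)

/-- `g(z) = f(z)² / z`. -/
def gfun (f : ℝ → ℝ) (z : ℝ) : ℝ := f z ^ 2 / z

/-- `(lam, α₀, δ₀, η)`-stability of a site-consistent chain with witness `f`. The function `η` is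
only evaluated on its domain `[0, 1]`. -/
structure IsStable {n : ℕ} (f : Fin n → ℝ → ℝ) (lam α₀ δ₀ : ℝ) (η : ℝ → ℝ) : Prop where
  α₀_pos : 0 < α₀
  α₀_le : α₀ ≤ lam
  η_zero : η 0 = 0
  η_mono : MonotoneOn η (Set.Icc 0 1)
  stable : ∀ i, ∀ a, α₀ ≤ a → ∃ zs : ℝ,
    (0 < zs ∧ gfun (f i) zs = gfun (f i) (Real.exp a * zs)) ∧
    (∀ z, 0 < z → gfun (f i) z = gfun (f i) (Real.exp a * z) → z = zs) ∧
    (∀ δ ∈ Set.Icc (0 : ℝ) 1, δ ≤ δ₀ →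
      ∀ z ∈ Set.Icc (Real.exp (-(2 * lam))) (Real.exp (2 * lam)),
        |gfun (f i) z - gfun (f i) (Real.exp a * z)| ≤ δ → |zs - z| ≤ η δ)

/-- `γ`-boundedness: for `x, y` with `x_i = y_i`,
`P_i(x, x^{i ↦ σ}) / P_i(y, y^{i ↦ σ}) ≤ exp(γ ∑_{k : x_k ≠ y_k} |A_{ik}|)`, with the
denominator cleared. -/
def IsBounded {n : ℕ} (A : Matrix (Fin n) (Fin n) ℝ)
    (P : Fin n → Matrix (Config n) (Config n) ℝ) (γ : ℝ) : Prop :=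
  ∀ (i : Fin n) (x y : Config n) (σ : ℤˣ), x i = y i →
    P i x (setSpin x i σ) ≤
      Real.exp (γ * ∑ k ∈ Finset.univ.filter (fun k => x k ≠ y k), |A i k|) *
        P i y (setSpin y i σ)

/-- The standing assumptions on the site kernels of the chain. -/
structure ChainAssumption {n : ℕ} (A : Matrix (Fin n) (Fin n) ℝ) (h : Fin n → ℝ)
    (P : Fin n → Matrix (Config n) (Config n) ℝ) (f : Fin n → ℝ → ℝ)
    (lam α δ₀ : ℝ) (η : ℝ → ℝ) (γ κ : ℝ) : Prop where
  singleSite : IsSingleSite P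
  reversible : IsReversible (ising A h) P
  consistent : IsSiteConsistent (ising A h) P f
  stable : IsStable f lam α δ₀ η
  γ_nonneg : 0 ≤ γ
  bounded : IsBounded A P γ
  κ_pos : 0 < κ
  flip_ge : ∀ i x, κ ≤ P i x (flipAt x i)

/-! ### The continuous-time chain -/

/-- The generator `𝓛 = ∑ᵢ (Pᵢ - I)`: each site kernel is applied at the times of an independent
Poisson clock of rate `1`. -/
def generator {n : ℕ} (P : Fin n → Matrix (Config n) (Config n) ℝ) :
    Matrix (Config n) (Config n) ℝ := ∑ i, (P i - 1)

/-- The transition matrices `H_t = exp(t 𝓛)`. -/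
def semigroup {n : ℕ} (P : Fin n → Matrix (Config n) (Config n) ℝ) (t : ℝ) :
    Matrix (Config n) (Config n) ℝ := NormedSpace.exp (t • generator P)

/-- The history `σ(X_u : u ≤ s)` of a process. -/
@[reducible] def history {n : ℕ} {Ω : Type*} (X : ℝ≥0 → Ω → Config n) (s : ℝ≥0) : MeasurableSpace Ω :=
  ⨆ u : ℝ≥0, ⨆ _ : u ≤ s, MeasurableSpace.comap (X u) inferInstance

/-- `X` is a continuous-time Markov chain with generator `∑ᵢ (Pᵢ - I)`, started from an arbitrary
initial law: its paths are right-continuous with left limits (in the finite discrete space of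
configurations), and given the history up to time `s` the law of `X_t` is `H_{t-s}(X_s, ·)`. -/
structure IsSingleSiteChain {n : ℕ} {Ω : Type*} [MeasurableSpace Ω] (μ : Measure Ω)
    (P : Fin n → Matrix (Config n) (Config n) ℝ) (X : ℝ≥0 → Ω → Config n) : Prop where
  measurable : ∀ t, Measurable (X t)
  right_cont : ∀ ω t, ContinuousWithinAt (fun u => X u ω) (Set.Ici t) t
  left_lim : ∀ ω t, ∃ y, Tendsto (fun u => X u ω) (𝓝[<] t) (𝓝 y)
  markov : ∀ s t : ℝ≥0, s ≤ t → ∀ y : Config n,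
    μ[{ω | X t ω = y}.indicator (fun _ => (1 : ℝ)) | history X s]
      =ᵐ[μ] fun ω => semigroup P ((t : ℝ) - s) (X s ω) y

/-! ### Observed flips and the cycle statistic -/

/-- The flip times `Π'_i` of site `i`: the times at which the spin at `i` differs from its left
limit. (At time `0` there is no left limit and `leftLim` is the value itself, so `0` is never a
flip time.) -/
def flipTimes {n : ℕ} {Ω : Type*} (X : ℝ≥0 → Ω → Config n) (i : Fin n) (ω : Ω) : Set ℝ≥0 :=
  {s | Function.leftLim (fun u => X u ω i) s ≠ X s ω i}

/-- The number of flips of site `i` in the time interval `[a, b]`. -/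
def flipCount {n : ℕ} {Ω : Type*} (X : ℝ≥0 → Ω → Config n) (i : Fin n) (a b : ℝ≥0) (ω : Ω) :
    ℕ∞ := (flipTimes X i ω ∩ Set.Icc a b).encard

/-- The observation filtration `𝓕_t = σ(X⁰, Π'_1(t), …, Π'_n(t))`: the random sets
`Π'_i(t) = Π'_i ∩ [0, t]` are observed through their numbers of points in intervals. -/
@[reducible] def obs {n : ℕ} {Ω : Type*} (X : ℝ≥0 → Ω → Config n) (t : ℝ≥0) : MeasurableSpace Ω :=
  MeasurableSpace.comap (X 0) inferInstance ⊔
    ⨆ i : Fin n, ⨆ a : ℝ≥0, ⨆ b : ℝ≥0, ⨆ _ : b ≤ t,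
      MeasurableSpace.comap (flipCount X i a b) inferInstance

/-- The event `𝓔^t_ℓ` for a sequence `ℓ ∈ {i, j}^m`: during
`I_k = [t + (k-1)ε, t + kε]` the site `ℓ_k` flips exactly once and the other site of the pair
`{i, j}` does not flip, for `k = 1, …, m`. -/
def flipEvent {n m : ℕ} {Ω : Type*} (X : ℝ≥0 → Ω → Config n) (i j : Fin n) (ε t : ℝ≥0)
    (l : Fin m → Fin n) : Set Ω :=
  {ω | ∀ k : Fin m, ∀ s : Fin n, s = i ∨ s = j →
    flipCount X s (t + (k : ℕ) * ε) (t + ((k : ℕ) + 1) * ε) ω = if s = l k then 1 else 0}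

/-- The degree-8 cycle statistic
`Z^{i,j}_t = 1{iijjiijj} - 2 · 1{iijjjiij} + 1{jiijjiij}`. -/
def cycleStat {n : ℕ} {Ω : Type*} (X : ℝ≥0 → Ω → Config n) (i j : Fin n) (ε t : ℝ≥0) (ω : Ω) :
    ℝ :=
  (flipEvent X i j ε t ![i, i, j, j, i, i, j, j]).indicator (fun _ => (1 : ℝ)) ω
    - 2 * (flipEvent X i j ε t ![i, i, j, j, j, i, i, j]).indicator (fun _ => (1 : ℝ)) ω
    + (flipEvent X i j ε t ![j, i, i, j, j, i, i, j]).indicator (fun _ => (1 : ℝ)) ω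

end

end FlipCycle

/-! Write `p_l(x)` for the probability that an update at `l` flips `x`. During a window of length
`ε`, site `l` flips and the other site of the pair does not with probability `ε p_l(x) + O(d ε²)`:
by `γ`-boundedness `p_i` and `p_j` depend only on the at most `4d` spins in a neighbourhood of the
pair, and each of these changes with probability at most `ε`. Chaining eight windows gives `ε⁸`
times the product of flip probabilities along the prescribed path, up to `O(d ε⁹)`
(`windowProb_sub_le`). This compares spins at the ends of windows; exact flip counts differ from it
only if some window contains two flips while every other window contains a change, which costs
another `O(ε⁹)` (`condExp_flipEvent`).

The three paths are closed, and along them flips pair up with their reversals. Detailed balance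
gives `p_i(x) p_i(x^{⊕i}) = g_i(r_i(x))` (`gfun_ratio`). With `u = g_i(r_i(x))`, `v =
g_i(r_i(x^{⊕j}))` and `w = g_j(r_j(x))`, the products are `w²u²`, `w²uv` and `w²v²`, so the
combination is the perfect square `w²(u - v)²` (`flipProd_cycles`). This is (a). It vanishes for
non-neighbours, where `r_i` ignores the spin at `j`; the tower property gives (b).

For (c), `w ≥ κ²`. If `|u - v| ≤ δ`, stability pins the smaller of the two ratios near one point
`z*`. Flipping a further neighbour `k` of `i` moves that ratio by more than stability permits, so
`x` or `x^{⊕k}` has a gap larger than `δ` (`lt_abs_gdiff_or`).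

It remains to show that the spin at `k` is sufficiently random after unit time (`evol_one_ge`). The
semigroup is expanded over words of site updates, keeping the words that contain `k` at most once.
Inserting a flip at `k` changes the probability of the other updates by a factor at least `exp(-γ ∑
|A_mk|)`, summed over the letters of the word; a tangent-line bound for the exponential controls the
average of this factor by the mean exponent, which is at most `γ lam`. Hence a good configuration is
reached with probability at least of order `κ exp(-2γ lam)`, from any state at time `t - 1`. -/

namespace FlipCycle

/-! ### Step paths -/

section Paths

variable {α : Type*} [TopologicalSpace α]

/-- Right-continuity with left limits. -/
structure IsCadlag (y : ℝ≥0 → α) : Prop where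
  right_cont : ∀ t, ContinuousWithinAt y (Set.Ici t) t
  left_lim : ∀ t, ∃ a, Tendsto y (𝓝[<] t) (𝓝 a)

/-- The jump times of a path. -/
def jumps (y : ℝ≥0 → α) : Set ℝ≥0 := {s | Function.leftLim y s ≠ y s}

/-- The `r`-th point of the partition of `[a, b]` into `N + 1` intervals of equal length. -/
noncomputable def gridPt (a b : ℝ≥0) (N r : ℕ) : ℝ≥0 := a + r * ((b - a) / (N + 1))

open Classical in
/-- The number of cells of the grid at whose end points the path takes different values. -/
noncomputable def changes (y : ℝ≥0 → α) (a b : ℝ≥0) (N : ℕ) : ℕ :=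
  ∑ r ∈ Finset.range (N + 1), if y (gridPt a b N r) ≠ y (gridPt a b N (r + 1)) then 1 else 0

variable {y : ℝ≥0 → α}

theorem IsCadlag.tendsto_leftLim (hy : IsCadlag y) (t : ℝ≥0) :
    Tendsto y (𝓝[<] t) (𝓝 (Function.leftLim y t)) :=
  tendsto_leftLim_of_tendsto (hy.left_lim t)

theorem zero_notMem_jumps (y : ℝ≥0 → α) : (0 : ℝ≥0) ∉ jumps y := by
  simp only [jumps, Set.mem_ofPred_eq, not_not]
  exact leftLim_eq_of_isBot isBot_bot

theorem ContinuousAt.notMem_jumps [T2Space α] {t : ℝ≥0} (h : ContinuousAt y t) : t ∉ jumps y := by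
  simp only [jumps, Set.mem_ofPred_eq, not_not]
  exact ContinuousWithinAt.leftLim_eq h.continuousWithinAt

theorem IsCadlag.continuousAt (hy : IsCadlag y) {t : ℝ≥0} (ht : t ∉ jumps y) :
    ContinuousAt y t := by
  simp only [jumps, Set.mem_ofPred_eq, not_not] at ht
  have h1 := hy.tendsto_leftLim t
  rw [ht] at h1
  have h2 := h1.sup (hy.right_cont t)
  rwa [nhdsLT_sup_nhdsGE] at h2

variable [DiscreteTopology α]

theorem IsCadlag.eq_of_no_jump (hy : IsCadlag y) {u v : ℝ≥0} (huv : u ≤ v)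
    (h : jumps y ∩ Set.Ioc u v = ∅) : y u = y v := by
  have hc : ContinuousOn y (Set.Icc u v) := by
    intro t ht
    rcases eq_or_lt_of_le ht.1 with rfl | hlt
    · exact (hy.right_cont _).mono Set.Icc_subset_Ici_self
    · refine (hy.continuousAt fun hj => ?_).continuousWithinAt
      exact Set.notMem_empty t (h ▸ ⟨hj, hlt, ht.2⟩)
  exact isPreconnected_Icc.constant hc (Set.left_mem_Icc.2 huv) (Set.right_mem_Icc.2 huv)

/-- The path is constant before the jump and constant from it on, so the left limit and the value at
the jump are the values at the two ends. -/
theorem IsCadlag.ne_of_one_jump (hy : IsCadlag y) {u v s : ℝ≥0}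
    (h : jumps y ∩ Set.Ioc u v = {s}) : y u ≠ y v := by
  have hs : s ∈ jumps y ∩ Set.Ioc u v := h ▸ Set.mem_singleton s
  have hsv : y s = y v := by
    refine hy.eq_of_no_jump hs.2.2 (Set.eq_empty_iff_forall_notMem.2 fun t ht => ?_)
    have : t ∈ ({s} : Set ℝ≥0) := h ▸ ⟨ht.1, hs.2.1.trans ht.2.1, ht.2.2⟩
    exact ht.2.1.ne' this
  have hev : ∀ᶠ w in 𝓝[<] s, y w = y u := by
    filter_upwards [Ioo_mem_nhdsLT hs.2.1] with w hw
    refine (hy.eq_of_no_jump hw.1.le (Set.eq_empty_iff_forall_notMem.2 fun t ht => ?_)).symm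
    have : t ∈ ({s} : Set ℝ≥0) := h ▸ ⟨ht.1, ht.2.1, ht.2.2.trans (hw.2.le.trans hs.2.2)⟩
    exact (ht.2.2.trans_lt hw.2).ne this
  have : (𝓝[<] s).NeBot := nhdsLT_neBot_of_exists_lt ⟨u, hs.2.1⟩
  have hl : Function.leftLim y s = y u :=
    leftLim_eq_of_tendsto (tendsto_nhds_of_eventually_eq hev)
  rw [← hl, ← hsv]
  exact hs.1

/-- Jump times are isolated: convergence in a discrete space means being eventually constant, so the
path is locally constant on each side of `t`. -/
theorem IsCadlag.eventually_notMem_jumps (hy : IsCadlag y) (t : ℝ≥0) :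
    ∀ᶠ u in 𝓝 t, u ≠ t → u ∉ jumps y := by
  have key : ∀ (S : Set ℝ≥0) (a : α), IsOpen S → (∀ᶠ u in 𝓝[S] t, y u = a) →
      ∀ᶠ u in 𝓝[S] t, u ∉ jumps y := by
    intro S a hS h
    rw [← eventually_eventually_nhdsWithin] at h
    filter_upwards [h, self_mem_nhdsWithin] with u hu huS
    rw [hS.nhdsWithin_eq huS] at hu
    refine ContinuousAt.notMem_jumps (?_ : Tendsto y (𝓝 u) (𝓝 (y u)))
    rw [hu.self_of_nhds]
    exact tendsto_nhds_of_eventually_eq hu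
  have hn (a : α) : ∀ᶠ z in 𝓝 a, z = a := by
    rw [nhds_discrete]
    exact eventually_pure.2 rfl
  have h1 := key (Set.Iio t) _ isOpen_Iio ((hy.tendsto_leftLim t).eventually (hn _))
  have h2 := key (Set.Ioi t) (y t) isOpen_Ioi
    (Tendsto.eventually ((hy.right_cont t).mono Set.Ioi_subset_Ici_self) (hn _))
  have h3 : ∀ᶠ u in 𝓝[≠] t, u ∉ jumps y := by
    rw [← nhdsLT_sup_nhdsGT]
    exact eventually_sup.2 ⟨h1, h2⟩
  exact eventually_nhdsWithin_iff.1 h3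

/-- A Lebesgue number for the cover of `[a, b]` by neighbourhoods containing no jump except possibly
their centre. -/
theorem IsCadlag.exists_fine (hy : IsCadlag y) (a b : ℝ≥0) :
    ∃ δ > 0, ∀ u v : ℝ≥0, a ≤ v → v ≤ b → (v : ℝ) - u < δ →
      (jumps y ∩ Set.Ioc u v).Subsingleton := by
  obtain ⟨δ, hδ, H⟩ := lebesgue_number_lemma_of_metric (isCompact_Icc (a := a) (b := b))
    (c := fun t : ℝ≥0 => interior {u | u ≠ t → u ∉ jumps y}) (fun _ => isOpen_interior)
    (fun t _ => Set.mem_iUnion.2 ⟨t, mem_interior_iff_mem_nhds.2 (hy.eventually_notMem_jumps t)⟩)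
  refine ⟨δ, hδ, fun u v hav hvb huv => ?_⟩
  obtain ⟨t, ht⟩ := H v ⟨hav, hvb⟩
  have : ∀ s ∈ jumps y ∩ Set.Ioc u v, s = t := by
    intro s hs
    have hs' : s ∈ Metric.ball v δ := by
      have h1 : (u : ℝ) < s := by exact_mod_cast hs.2.1
      have h2 : (s : ℝ) ≤ v := by exact_mod_cast hs.2.2
      rw [Metric.mem_ball, NNReal.dist_eq, abs_lt]
      constructor <;> linarith
    by_contra hne
    exact interior_subset (ht hs') hne hs.1
  intro s hs s' hs'
  rw [this s hs, this s' hs']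

open Classical in
theorem IsCadlag.encard_cell (hy : IsCadlag y) {u v : ℝ≥0} (huv : u ≤ v)
    (h : (jumps y ∩ Set.Ioc u v).Subsingleton) :
    (jumps y ∩ Set.Ioc u v).encard = if y u ≠ y v then 1 else 0 := by
  rcases h.eq_empty_or_singleton with h0 | ⟨s, hs⟩
  · rw [h0, Set.encard_empty, if_neg (not_not.2 (hy.eq_of_no_jump huv h0))]
  · rw [if_pos (hy.ne_of_one_jump hs), hs, Set.encard_singleton]

theorem encard_inter_Ioc_sum (S : Set ℝ≥0) {t : ℕ → ℝ≥0} (ht : Monotone t) (m : ℕ) :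
    (S ∩ Set.Ioc (t 0) (t m)).encard =
      ∑ r ∈ Finset.range m, (S ∩ Set.Ioc (t r) (t (r + 1))).encard := by
  induction m with
  | zero => simp
  | succ m ih =>
    rw [Finset.sum_range_succ, ← ih, ← Set.encard_union_eq, ← Set.inter_union_distrib_left,
      Set.Ioc_union_Ioc_eq_Ioc (ht (Nat.zero_le m)) (ht (Nat.le_succ m))]
    rw [Set.disjoint_left]
    rintro s ⟨_, hs⟩ ⟨_, hs'⟩
    exact (hs.2.trans_lt hs'.1).false

theorem gridPt_zero (a b : ℝ≥0) (N : ℕ) : gridPt a b N 0 = a := by simp [gridPt]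

theorem gridPt_last {a b : ℝ≥0} (hab : a ≤ b) (N : ℕ) : gridPt a b N (N + 1) = b := by
  have h : ((N : ℝ≥0) + 1) ≠ 0 := by positivity
  rw [gridPt]
  push_cast
  rw [mul_div_cancel₀ _ h, add_tsub_cancel_of_le hab]

theorem gridPt_mono (a b : ℝ≥0) (N : ℕ) : Monotone (gridPt a b N) := by
  intro r s hrs
  unfold gridPt
  gcongr

theorem gridPt_succ (a b : ℝ≥0) (N r : ℕ) :
    gridPt a b N (r + 1) = gridPt a b N r + (b - a) / (N + 1) := by
  unfold gridPt
  push_cast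
  ring

theorem tendsto_div_add_one_zero (x : ℝ) :
    Tendsto (fun N : ℕ => x / ((N : ℝ) + 1)) atTop (𝓝 0) := by
  simpa [div_eq_mul_inv] using tendsto_one_div_add_atTop_nhds_zero_nat.const_mul x

/-- On a fine enough grid each cell has at most one jump, so jumps are counted by comparing end
points. This expresses flip counts through countably many values of the path, as needed both for
measurability and for probability bounds. -/
theorem IsCadlag.eventually_changes (hy : IsCadlag y) {a b : ℝ≥0} (hab : a ≤ b) :
    ∀ᶠ N in atTop, (changes y a b N : ℕ∞) = (jumps y ∩ Set.Ioc a b).encard := by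
  obtain ⟨δ, hδ, H⟩ := hy.exists_fine a b
  have hlim : Tendsto (fun N : ℕ => (((b - a : ℝ≥0) : ℝ)) / ((N : ℝ) + 1)) atTop (𝓝 0) :=
    tendsto_div_add_one_zero _
  filter_upwards [hlim.eventually (gt_mem_nhds hδ)] with N hN
  have hsum := encard_inter_Ioc_sum (jumps y) (gridPt_mono a b N) (N + 1)
  rw [gridPt_zero, gridPt_last hab] at hsum
  rw [hsum, changes, Nat.cast_sum]
  refine Finset.sum_congr rfl fun r hr => ?_
  have hr' : r + 1 ≤ N + 1 := by simpa using hr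
  rw [hy.encard_cell (gridPt_mono a b N (Nat.le_succ r))]
  · split_ifs <;> simp
  · refine H _ _ ?_ ?_ ?_
    · refine (gridPt_zero a b N).symm.trans_le ?_
      exact gridPt_mono a b N (Nat.zero_le _)
    · exact (gridPt_mono a b N hr').trans_eq (gridPt_last hab N)
    · rw [gridPt_succ]
      push_cast
      simpa using hN

/-- Passes from half-open intervals to the closed ones of `flipCount`: jumps do not accumulate at
`a` from the left. The margin `a / (l + 1)` keeps the left end nonnegative, and for `a = 0` there is
no jump at `0` to lose. -/
theorem IsCadlag.eventually_Icc (hy : IsCadlag y) (a b : ℝ≥0) :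
    ∀ᶠ l : ℕ in atTop,
      jumps y ∩ Set.Ioc (a - a / (l + 1)) b = jumps y ∩ Set.Icc a b := by
  rcases eq_or_lt_of_le (zero_le (a := a)) with rfl | ha
  · refine Eventually.of_forall fun l => ?_
    ext s
    simp only [zero_div, tsub_zero, Set.mem_inter_iff, Set.mem_Ioc, Set.mem_Icc, zero_le, true_and,
      and_congr_right_iff, and_iff_right_iff_imp]
    intro hs _
    exact pos_iff_ne_zero.2 fun h => zero_notMem_jumps y (h ▸ hs)
  obtain ⟨w, hw, hwa⟩ := (mem_nhdsLT_iff_exists_Ioo_subset' ha).1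
    ((eventually_nhdsWithin_of_eventually_nhds (hy.eventually_notMem_jumps a)).and
      self_mem_nhdsWithin)
  have hlim : Tendsto (fun l : ℕ => (a : ℝ) / ((l : ℝ) + 1)) atTop (𝓝 0) :=
    tendsto_div_add_one_zero _
  have hpos : (0 : ℝ) < a - w := sub_pos.2 (by exact_mod_cast hw)
  filter_upwards [hlim.eventually (gt_mem_nhds hpos)] with l hl
  have hle : a / (l + 1) ≤ a := div_le_self (zero_le (a := a)) (by simp)
  have hwl : w < a - a / (l + 1) := by
    rw [← NNReal.coe_lt_coe, NNReal.coe_sub hle]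
    push_cast
    linarith
  have hlt : a - a / (l + 1) < a := tsub_lt_self ha (by positivity)
  ext s
  simp only [Set.mem_inter_iff, Set.mem_Ioc, Set.mem_Icc, and_congr_right_iff,
    and_congr_left_iff]
  intro hs _
  refine ⟨fun h => ?_, fun h => hlt.trans_le h⟩
  by_contra hcon
  have := hwa ⟨hwl.trans h, not_le.1 hcon⟩
  exact this.1 (not_le.1 hcon).ne hs

/-- A path in the two-point group changes sign at each jump. -/
theorem IsCadlag.eq_mul_pow {y : ℝ≥0 → ℤˣ} (hy : IsCadlag y) {a b : ℝ≥0} (hab : a ≤ b) :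
    y b = y a * (-1) ^ (jumps y ∩ Set.Ioc a b).encard.toNat := by
  obtain ⟨N, hN⟩ := (hy.eventually_changes hab).exists
  -- The count agrees with a finite number of grid changes, so `ENat.toNat` loses nothing here.
  rw [← hN, ENat.toNat_natCast]
  have key : ∀ m, y (gridPt a b N m) = y (gridPt a b N 0) * (-1) ^ (∑ r ∈ Finset.range m,
      if y (gridPt a b N r) ≠ y (gridPt a b N (r + 1)) then 1 else 0) := by
    intro m
    induction m with
    | zero => simp
    | succ m ih =>
      rw [Finset.sum_range_succ, pow_add, ← mul_assoc, ← ih]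
      split_ifs with h
      · rw [pow_one, mul_neg_one]
        exact Int.units_ne_iff_eq_neg.1 (Ne.symm h)
      · rw [pow_zero, mul_one]
        exact (not_not.1 h).symm
  have := key (N + 1)
  rw [gridPt_zero, gridPt_last hab] at this
  rw [this, changes]
  congr!

end Paths

end FlipCycle

namespace FlipCycle

/-! ### Measurability of the flip counts -/

instance : DiscreteMeasurableSpace ℤˣ :=
  ⟨fun s => ⟨Units.val '' s, MeasurableSet.of_discrete, Units.val_injective.preimage_image s⟩⟩

theorem measurable_of_eventually_eq {Ω β : Type*} [MeasurableSpace Ω] [MeasurableSpace β]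
    [Countable β] [MeasurableSingletonClass β] {f : ℕ → Ω → β} {g : Ω → β}
    (hf : ∀ N, Measurable (f N)) (h : ∀ ω, ∀ᶠ N in atTop, f N ω = g ω) : Measurable g := by
  refine measurable_to_countable' fun x => ?_
  have : g ⁻¹' {x} = ⋃ K : ℕ, ⋂ N : ℕ, ⋂ _ : K ≤ N, f N ⁻¹' {x} := by
    ext ω
    simp only [Set.mem_preimage, Set.mem_singleton_iff, Set.mem_iUnion, Set.mem_iInter]
    constructor
    · rintro rfl
      exact eventually_atTop.1 (h ω)
    · intro hK
      obtain ⟨N, h1, h2⟩ := ((eventually_atTop.2 hK).and (h ω)).exists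
      exact h2.symm.trans h1
  rw [this]
  exact .iUnion fun K => .iInter fun N => .iInter fun _ => hf N (measurableSet_singleton x)

variable {n : ℕ} {Ω : Type*}

theorem history_mono (X : ℝ≥0 → Ω → Config n) : Monotone (history X) := fun _ _ hst =>
  iSup_mono fun _ => iSup_mono' fun hu => ⟨hu.trans hst, le_rfl⟩

theorem measurable_history (X : ℝ≥0 → Ω → Config n) {u s : ℝ≥0} (h : u ≤ s) :
    Measurable[history X s] (X u) :=
  measurable_iff_comap_le.2 (le_iSup₂_of_le u h le_rfl)

theorem measurableSet_history_two (X : ℝ≥0 → Ω → Config n) {u v s : ℝ≥0} (hu : u ≤ s)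
    (hv : v ≤ s) (p : Config n → Config n → Prop) :
    MeasurableSet[history X s] {ω | p (X u ω) (X v ω)} := by
  let _ := history X s
  have h := (measurable_history X hu).prodMk (measurable_history X hv)
  exact h (MeasurableSet.of_discrete (s := {q : Config n × Config n | p q.1 q.2}))

/-- The spin at `i` or `j` is different at the times `s` and `t`. -/
def pairChange (X : ℝ≥0 → Ω → Config n) (i j : Fin n) (s t : ℝ≥0) : Set Ω :=
  {ω | X t ω i ≠ X s ω i ∨ X t ω j ≠ X s ω j}

theorem measurableSet_pairChange (X : ℝ≥0 → Ω → Config n) (i j : Fin n) {s t : ℝ≥0}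
    (hst : s ≤ t) : MeasurableSet[history X t] (pairChange X i j s t) :=
  measurableSet_history_two X hst le_rfl fun x y => y i ≠ x i ∨ y j ≠ x j

theorem measurable_changes (X : ℝ≥0 → Ω → Config n) (i : Fin n) {a b : ℝ≥0} (hab : a ≤ b)
    (N : ℕ) : Measurable[history X b] fun ω => changes (fun u => X u ω i) a b N := by
  classical
  unfold changes
  let _ := history X b
  refine Finset.measurable_sum _ fun r hr => ?_
  refine Measurable.ite (measurableSet_history_two X ?_ ?_ fun x y => x i ≠ y i)
    measurable_const measurable_const
  all_goals
    refine (gridPt_mono a b N ?_).trans_eq (gridPt_last hab N)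
    have := Finset.mem_range.1 hr
    omega

/-- The paths of a chain are right-continuous with left limits at each site. -/
def HasCadlagPaths (X : ℝ≥0 → Ω → Config n) : Prop := ∀ ω i, IsCadlag fun u => X u ω i

theorem HasCadlagPaths.measurable_Ioc {X : ℝ≥0 → Ω → Config n} (hX : HasCadlagPaths X)
    (i : Fin n) {a b : ℝ≥0} (hab : a ≤ b) :
    Measurable[history X b] fun ω => (jumps (fun u => X u ω i) ∩ Set.Ioc a b).encard :=
  @measurable_of_eventually_eq _ _ (history X b) _ _ _ _ _
    (fun N => (measurable_of_countable (fun k : ℕ => (k : ℕ∞))).comp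
      (measurable_changes X i hab N)) fun ω => (hX ω i).eventually_changes hab

theorem HasCadlagPaths.measurable_flipCount {X : ℝ≥0 → Ω → Config n} (hX : HasCadlagPaths X)
    (i : Fin n) (a b : ℝ≥0) : Measurable[history X b] (flipCount X i a b) := by
  rcases le_or_gt a b with hab | hab
  · refine @measurable_of_eventually_eq _ _ (history X b) _ _ _ _ _
      (fun l => hX.measurable_Ioc i ((tsub_le_self (b := a / (l + 1))).trans hab)) fun ω => ?_
    filter_upwards [(hX ω i).eventually_Icc a b] with l hl
    rw [hl]
    rfl
  · have : flipCount X i a b = fun _ => 0 := by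
      funext ω
      simp [flipCount, Set.Icc_eq_empty_of_lt hab]
    rw [this]
    exact measurable_const

theorem HasCadlagPaths.obs_le_history {X : ℝ≥0 → Ω → Config n} (hX : HasCadlagPaths X)
    (t : ℝ≥0) : obs X t ≤ history X t := by
  refine sup_le (measurable_iff_comap_le.1 (measurable_history X (zero_le (a := t)))) ?_
  refine iSup_le fun i => iSup_le fun a => iSup_le fun b => iSup_le fun hb => ?_
  exact (measurable_iff_comap_le.1 (hX.measurable_flipCount i a b)).trans (history_mono X hb)

theorem comap_flipCount_le_obs (X : ℝ≥0 → Ω → Config n) (i : Fin n) (a : ℝ≥0) {b t : ℝ≥0}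
    (hb : b ≤ t) : MeasurableSpace.comap (flipCount X i a b) inferInstance ≤ obs X t :=
  le_sup_of_le_right (le_iSup_of_le i (le_iSup_of_le a (le_iSup_of_le b (le_iSup_of_le hb le_rfl))))

theorem obs_mono (X : ℝ≥0 → Ω → Config n) : Monotone (obs X) := by
  intro s t hst
  refine sup_le (le_sup_of_le_left le_rfl) ?_
  refine iSup_le fun i => iSup_le fun a => iSup_le fun b => iSup_le fun hb => ?_
  exact comap_flipCount_le_obs X i a (hb.trans hst)

theorem flipTimes_inter_Icc_zero (X : ℝ≥0 → Ω → Config n) (i : Fin n) (t : ℝ≥0) (ω : Ω) :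
    flipTimes X i ω ∩ Set.Icc 0 t = jumps (fun u => X u ω i) ∩ Set.Ioc 0 t := by
  ext s
  simp only [Set.mem_inter_iff, Set.mem_Icc, Set.mem_Ioc]
  refine ⟨fun h => ⟨h.1, pos_iff_ne_zero.2 fun h0 => ?_, h.2.2⟩,
    fun h => ⟨h.1, h.2.1.le, h.2.2⟩⟩
  exact zero_notMem_jumps _ (h0 ▸ h.1)

/-- The current spin is the initial spin times the parity of the number of flips. Together with
`obs_le_history`, this lets the Markov property for the full history be used for the observation
filtration. -/
theorem HasCadlagPaths.measurable_obs {X : ℝ≥0 → Ω → Config n} (hX : HasCadlagPaths X)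
    (t : ℝ≥0) : Measurable[obs X t] (X t) := by
  refine @measurable_pi_lambda _ _ _ (obs X t) _ _ fun i => ?_
  have h0 : Measurable[obs X t] fun ω => X 0 ω i :=
    (measurable_pi_apply i).comp (measurable_iff_comap_le.2 le_sup_left)
  have h1 : Measurable[obs X t] (flipCount X i 0 t) :=
    measurable_iff_comap_le.2 (comap_flipCount_le_obs X i 0 le_rfl)
  have h2 : (fun ω => X t ω i) =
      (fun q : ℤˣ × ℕ∞ => q.1 * (-1) ^ q.2.toNat) ∘ fun ω => (X 0 ω i, flipCount X i 0 t ω) := by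
    funext ω
    have := (hX ω i).eq_mul_pow (zero_le (a := t))
    simp only [Function.comp, flipCount, flipTimes_inter_Icc_zero]
    exact this
  let _ := obs X t
  rw [h2]
  exact (measurable_of_countable _).comp (h0.prodMk h1)

variable [MeasurableSpace Ω] {μ : Measure Ω} {P : Fin n → Matrix (Config n) (Config n) ℝ}
  {X : ℝ≥0 → Ω → Config n}

theorem IsSingleSiteChain.hasCadlagPaths (hX : IsSingleSiteChain μ P X) : HasCadlagPaths X :=
  fun ω i => ⟨fun t => (continuous_apply i).continuousAt.comp_continuousWithinAt
    (hX.right_cont ω t), fun t => (hX.left_lim ω t).imp' (fun y => y i) fun y hy =>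
      ((continuous_apply i).tendsto y).comp hy⟩

theorem IsSingleSiteChain.history_le (hX : IsSingleSiteChain μ P X) (s : ℝ≥0) :
    history X s ≤ ‹MeasurableSpace Ω› :=
  iSup₂_le fun u _ => (hX.measurable u).comap_le

theorem IsSingleSiteChain.obs_le (hX : IsSingleSiteChain μ P X) (s : ℝ≥0) :
    obs X s ≤ ‹MeasurableSpace Ω› :=
  (hX.hasCadlagPaths.obs_le_history s).trans (hX.history_le s)

end FlipCycle

namespace FlipCycle

open scoped Matrix

/-! ### Exponentials of matrices with nonnegative entries -/

section MatrixExp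

variable {S : Type*} [Fintype S] [DecidableEq S]

attribute [local instance] Matrix.linftyOpNormedRing Matrix.linftyOpNormedAlgebra

theorem hasSum_exp_mulVec (M : Matrix S S ℝ) (φ : S → ℝ) (x : S) :
    HasSum (fun N : ℕ => ((N.factorial : ℝ))⁻¹ * ((M ^ N) *ᵥ φ) x)
      ((NormedSpace.exp M *ᵥ φ) x) := by
  have h := NormedSpace.exp_series_hasSum_exp' (𝕂 := ℝ) M
  have h2 := h.map (⟨⟨fun B : Matrix S S ℝ => (B *ᵥ φ) x, by simp⟩,
    fun B B' => by simp [Matrix.add_mulVec]⟩ : Matrix S S ℝ →+ ℝ) (by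
      change Continuous fun B : Matrix S S ℝ => (B *ᵥ φ) x
      exact (continuous_apply x).comp (continuous_id.matrix_mulVec continuous_const))
  convert h2 using 2 with N
  · simp [Matrix.smul_mulVec]
  · rfl

theorem exp_smul_sub_smul_one (R : Matrix S S ℝ) (c t : ℝ) :
    NormedSpace.exp (t • (R - c • (1 : Matrix S S ℝ))) =
      Real.exp (-(t * c)) • NormedSpace.exp (t • R) := by
  have h1 : t • (R - c • (1 : Matrix S S ℝ)) = (-(t * c)) • (1 : Matrix S S ℝ) + t • R := by
    rw [smul_sub, smul_smul, neg_smul]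
    abel
  rw [h1, Matrix.exp_add_of_commute _ _ ((Commute.one_left _).smul_left _)]
  have h2 : NormedSpace.exp ((-(t * c)) • (1 : Matrix S S ℝ)) =
      Real.exp (-(t * c)) • (1 : Matrix S S ℝ) := by
    rw [← Matrix.diagonal_one, ← Matrix.diagonal_smul, Matrix.exp_diagonal]
    ext a b
    rw [← Matrix.diagonal_smul]
    simp only [Matrix.diagonal_apply, Real.exp_eq_exp_ℝ]
    split_ifs with h
    · rw [Pi.coe_exp]
      simp
    · rfl
  rw [h2, smul_mul_assoc, one_mul]

theorem hasDerivAt_exp_smul_mulVec (Q : Matrix S S ℝ) (φ : S → ℝ) (x : S) (t : ℝ) :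
    HasDerivAt (fun s : ℝ => (NormedSpace.exp (s • Q) *ᵥ φ) x)
      ((NormedSpace.exp (t • Q) *ᵥ (Q *ᵥ φ)) x) t := by
  have h := hasDerivAt_exp_smul_const (𝕂 := ℝ) Q t
  let L : Matrix S S ℝ →ₗ[ℝ] ℝ :=
    ⟨⟨fun B => (B *ᵥ φ) x, fun B B' => by simp [Matrix.add_mulVec]⟩,
      fun c B => by simp [Matrix.smul_mulVec]⟩
  have := L.toContinuousLinearMap.hasFDerivAt.comp_hasDerivAt t h
  rw [Matrix.mulVec_mulVec]
  exact this

end MatrixExp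

theorem mulVec_nonneg {S : Type*} [Fintype S] {M : Matrix S S ℝ} (hM : ∀ x y, 0 ≤ M x y)
    {φ : S → ℝ} (hφ : ∀ x, 0 ≤ φ x) (x : S) : 0 ≤ (M *ᵥ φ) x :=
  Finset.sum_nonneg fun y _ => mul_nonneg (hM x y) (hφ y)

theorem pow_mulVec_nonneg {S : Type*} [Fintype S] [DecidableEq S] {M : Matrix S S ℝ}
    (hM : ∀ x y, 0 ≤ M x y) {φ : S → ℝ} (hφ : ∀ x, 0 ≤ φ x) (N : ℕ) :
    ∀ x, 0 ≤ ((M ^ N) *ᵥ φ) x := by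
  induction N with
  | zero => simpa using hφ
  | succ N ih =>
    rw [pow_succ', ← Matrix.mulVec_mulVec]
    exact mulVec_nonneg hM ih

theorem mulVec_mono {S : Type*} [Fintype S] {M : Matrix S S ℝ} (hM : ∀ x y, 0 ≤ M x y)
    {φ ψ : S → ℝ} (h : ∀ x, φ x ≤ ψ x) (x : S) : (M *ᵥ φ) x ≤ (M *ᵥ ψ) x :=
  Finset.sum_le_sum fun y _ => mul_le_mul_of_nonneg_left (h y) (hM x y)

theorem pow_mulVec_const {S : Type*} [Fintype S] [DecidableEq S] {M : Matrix S S ℝ} {c : ℝ}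
    (hM : ∀ x, ∑ y, M x y = c) (a : ℝ) (N : ℕ) :
    ((M ^ N) *ᵥ fun _ => a) = fun _ => c ^ N * a := by
  induction N generalizing a with
  | zero => simp
  | succ N ih =>
    have h1 : (M *ᵥ fun _ => a) = fun _ => c * a := by
      funext x
      simp [Matrix.mulVec, dotProduct, ← Finset.sum_mul, hM]
    rw [pow_succ, ← Matrix.mulVec_mulVec, h1, ih]
    funext x
    ring

theorem exp_mulVec_nonneg {S : Type*} [Fintype S] [DecidableEq S] {M : Matrix S S ℝ}
    (hM : ∀ x y, 0 ≤ M x y) {φ : S → ℝ} (hφ : ∀ x, 0 ≤ φ x) (x : S) :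
    0 ≤ (NormedSpace.exp M *ᵥ φ) x :=
  (hasSum_exp_mulVec M φ x).nonneg fun N =>
    mul_nonneg (by positivity) (pow_mulVec_nonneg hM hφ N x)

theorem hasSum_real_exp (c : ℝ) :
    HasSum (fun N : ℕ => ((N.factorial : ℝ))⁻¹ * c ^ N) (Real.exp c) := by
  rw [Real.exp_eq_exp_ℝ]
  simpa [div_eq_inv_mul] using NormedSpace.expSeries_div_hasSum_exp c

theorem exp_mulVec_const {S : Type*} [Fintype S] [DecidableEq S] {M : Matrix S S ℝ} {c : ℝ}
    (hM : ∀ x, ∑ y, M x y = c) (a : ℝ) (x : S) :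
    (NormedSpace.exp M *ᵥ fun _ => a) x = Real.exp c * a := by
  refine (hasSum_exp_mulVec M _ x).unique ?_
  simp_rw [pow_mulVec_const hM, ← mul_assoc]
  exact (hasSum_real_exp c).mul_right a

/-! ### The semigroup of a single-site chain -/

variable {n : ℕ} {P : Fin n → Matrix (Config n) (Config n) ℝ}

/-- The action of the semigroup on functions. -/
noncomputable def evol (P : Fin n → Matrix (Config n) (Config n) ℝ) (t : ℝ) (φ : Config n → ℝ) :
    Config n → ℝ := semigroup P t *ᵥ φ

/-- The probability that an update at `i` flips the spin. -/
def flipProb (P : Fin n → Matrix (Config n) (Config n) ℝ) (i : Fin n) (x : Config n) : ℝ :=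
  P i x (flipAt x i)

theorem flipAt_self (x : Config n) (i : Fin n) : flipAt x i i = -x i := by
  simp [flipAt, setSpin]

theorem flipAt_of_ne (x : Config n) {i k : Fin n} (h : k ≠ i) : flipAt x i k = x k := by
  simp [flipAt, setSpin, h]

theorem flipAt_flipAt (x : Config n) (i : Fin n) : flipAt (flipAt x i) i = x := by
  funext k
  by_cases h : k = i
  · subst h
    simp [flipAt_self]
  · simp [flipAt_of_ne, h]

theorem neg_unit_ne (a : ℤˣ) : -a ≠ a := by
  rcases Int.units_eq_one_or a with rfl | rfl <;> decide

theorem flipAt_ne (x : Config n) (i : Fin n) : flipAt x i ≠ x := fun h =>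
  neg_unit_ne (x i) ((flipAt_self x i).symm.trans (congrFun h i))

theorem generator_eq (P : Fin n → Matrix (Config n) (Config n) ℝ) :
    generator P = ∑ i, P i - (n : ℝ) • (1 : Matrix (Config n) (Config n) ℝ) := by
  simp [generator, Finset.sum_sub_distrib, Nat.cast_smul_eq_nsmul]

/-- Uniformization: the exponential of a matrix with nonnegative entries, rescaled. Positivity and
the expansion over words of updates are read off from this form. -/
theorem evol_eq (P : Fin n → Matrix (Config n) (Config n) ℝ) (t : ℝ) (φ : Config n → ℝ)
    (x : Config n) :
    evol P t φ x = Real.exp (-(t * n)) * (NormedSpace.exp (t • ∑ i, P i) *ᵥ φ) x := by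
  rw [evol, semigroup, generator_eq, exp_smul_sub_smul_one, Matrix.smul_mulVec]
  rfl

theorem evol_zero (P : Fin n → Matrix (Config n) (Config n) ℝ) (φ : Config n → ℝ) :
    evol P 0 φ = φ := by
  simp [evol, semigroup, NormedSpace.exp_zero]

theorem hasDerivAt_evol (P : Fin n → Matrix (Config n) (Config n) ℝ) (φ : Config n → ℝ)
    (x : Config n) (t : ℝ) :
    HasDerivAt (fun s => evol P s φ x) (evol P t (generator P *ᵥ φ) x) t :=
  hasDerivAt_exp_smul_mulVec _ φ x t

theorem evol_sub (t : ℝ) (φ ψ : Config n → ℝ) (x : Config n) :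
    evol P t (fun y => φ y - ψ y) x = evol P t φ x - evol P t ψ x :=
  congrFun (Matrix.mulVec_sub (semigroup P t) φ ψ) x

theorem evol_mul_const (t : ℝ) (φ : Config n → ℝ) (c : ℝ) (x : Config n) :
    evol P t (fun y => φ y * c) x = evol P t φ x * c := by
  simp [evol, Matrix.mulVec, dotProduct, Finset.sum_mul, mul_assoc]

theorem evol_sum {ι : Type*} (T : Finset ι) (t : ℝ) (φ : ι → Config n → ℝ) (x : Config n) :
    evol P t (fun y => ∑ m ∈ T, φ m y) x = ∑ m ∈ T, evol P t (φ m) x := by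
  simp only [evol, Matrix.mulVec, dotProduct, Finset.mul_sum]
  exact Finset.sum_comm

theorem IsSingleSite.sum_nonneg (hP : IsSingleSite P) (T : Finset (Fin n)) {t : ℝ} (ht : 0 ≤ t)
    (x y : Config n) : 0 ≤ (t • ∑ i ∈ T, P i) x y := by
  rw [Matrix.smul_apply, Matrix.sum_apply]
  exact mul_nonneg ht (Finset.sum_nonneg fun i _ => hP.nonneg i x y)

theorem IsSingleSite.row_sum (hP : IsSingleSite P) (T : Finset (Fin n)) (t : ℝ) (x : Config n) :
    ∑ y, (t • ∑ i ∈ T, P i) x y = t * T.card := by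
  simp only [Matrix.smul_apply, Matrix.sum_apply, smul_eq_mul, ← Finset.mul_sum]
  rw [Finset.sum_comm]
  simp [hP.sum_eq_one]

theorem IsSingleSite.evol_nonneg (hP : IsSingleSite P) {t : ℝ} (ht : 0 ≤ t) {φ : Config n → ℝ}
    (hφ : ∀ x, 0 ≤ φ x) (x : Config n) : 0 ≤ evol P t φ x := by
  rw [evol_eq]
  exact mul_nonneg (Real.exp_nonneg _) (exp_mulVec_nonneg (hP.sum_nonneg _ ht) hφ x)

theorem IsSingleSite.evol_const (hP : IsSingleSite P) (t a : ℝ) (x : Config n) :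
    evol P t (fun _ => a) x = a := by
  rw [evol_eq, exp_mulVec_const (hP.row_sum _ t), ← mul_assoc, ← Real.exp_add]
  simp

theorem IsSingleSite.evol_mono (hP : IsSingleSite P) {t : ℝ} (ht : 0 ≤ t) {φ ψ : Config n → ℝ}
    (h : ∀ x, φ x ≤ ψ x) (x : Config n) : evol P t φ x ≤ evol P t ψ x := by
  have := hP.evol_nonneg ht (φ := fun y => ψ y - φ y) (fun y => sub_nonneg.2 (h y)) x
  rw [evol_sub] at this
  linarith

theorem IsSingleSite.abs_evol_le (hP : IsSingleSite P) {t : ℝ} (ht : 0 ≤ t) {φ ψ : Config n → ℝ}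
    (h : ∀ x, |φ x| ≤ ψ x) (x : Config n) : |evol P t φ x| ≤ evol P t ψ x := by
  have h0 : evol P t (fun y => 0 - φ y) x = 0 - evol P t φ x := by
    rw [evol_sub, hP.evol_const]
  refine abs_le.2 ⟨?_, hP.evol_mono ht (fun y => (abs_le.1 (h y)).2) x⟩
  have := hP.evol_mono ht (φ := fun y => 0 - φ y) (ψ := ψ)
    (fun y => by linarith [(abs_le.1 (h y)).1]) x
  linarith

/-- Integrates the Kolmogorov equation `d/ds H_s φ = H_s 𝓛 φ` from `0` to `h`. -/
theorem evol_le_of_deriv {φ : Config n → ℝ} {x : Config n}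
    {K b h : ℝ} (hh : 0 ≤ h)
    (H : ∀ s ∈ Set.Icc 0 h, evol P s (generator P *ᵥ φ) x ≤ K + b * s) :
    evol P h φ x ≤ φ x + K * h + b * h ^ 2 / 2 := by
  have hd (s : ℝ) : HasDerivAt (fun s => K * s + b * s ^ 2 / 2 - evol P s φ x)
      (K + b * s - evol P s (generator P *ᵥ φ) x) s := by
    have h1 := ((hasDerivAt_id s).const_mul K).add
      ((((hasDerivAt_id s).pow 2).const_mul b).div_const 2)
    refine (h1.sub (hasDerivAt_evol P φ x s)).congr_deriv ?_
    simp
    ring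
  have hmono : MonotoneOn (fun s => K * s + b * s ^ 2 / 2 - evol P s φ x) (Set.Icc 0 h) := by
    refine monotoneOn_of_deriv_nonneg (convex_Icc 0 h)
      (fun s _ => (hd s).continuousAt.continuousWithinAt)
      (fun s _ => (hd s).differentiableAt.differentiableWithinAt) fun s hs => ?_
    rw [(hd s).deriv, sub_nonneg]
    exact H s (interior_subset hs)
  have := hmono (Set.left_mem_Icc.2 hh) (Set.right_mem_Icc.2 hh) hh
  simp only [evol_zero] at this
  linarith

theorem le_evol_of_deriv {φ : Config n → ℝ} {x : Config n}
    {K b h : ℝ} (hh : 0 ≤ h)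
    (H : ∀ s ∈ Set.Icc 0 h, K + b * s ≤ evol P s (generator P *ᵥ φ) x) :
    φ x + K * h + b * h ^ 2 / 2 ≤ evol P h φ x := by
  have key (s : ℝ) (χ : Config n → ℝ) : evol P s (-χ) x = -evol P s χ x :=
    congrFun (Matrix.mulVec_neg χ (semigroup P s)) x
  have := evol_le_of_deriv (P := P) (φ := -φ) (x := x) (K := -K) (b := -b) hh fun s hs => by
    rw [Matrix.mulVec_neg, key]
    linarith [H s hs]
  rw [key, Pi.neg_apply] at this
  linarith

theorem IsSingleSite.mulVec_eq (hP : IsSingleSite P) (i : Fin n) (φ : Config n → ℝ)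
    (x : Config n) : (P i *ᵥ φ) x = φ x + flipProb P i x * (φ (flipAt x i) - φ x) := by
  have h1 : (P i *ᵥ φ) x = P i x x * φ x + P i x (flipAt x i) * φ (flipAt x i) := by
    rw [Matrix.mulVec, dotProduct]
    exact Fintype.sum_eq_add _ _ (flipAt_ne x i).symm fun y hy => by
      rw [hP.support i x y hy.1 hy.2, zero_mul]
  have h2 : P i x x + P i x (flipAt x i) = 1 := by
    rw [← hP.sum_eq_one i x]
    exact (Fintype.sum_eq_add _ _ (flipAt_ne x i).symm fun y hy =>
      hP.support i x y hy.1 hy.2).symm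
  rw [h1, flipProb]
  linear_combination φ x * h2

theorem IsSingleSite.flipProb_nonneg (hP : IsSingleSite P) (i : Fin n) (x : Config n) :
    0 ≤ flipProb P i x := hP.nonneg _ _ _

theorem IsSingleSite.flipProb_le_one (hP : IsSingleSite P) (i : Fin n) (x : Config n) :
    flipProb P i x ≤ 1 := by
  rw [← hP.sum_eq_one i x]
  exact Finset.single_le_sum (f := fun y => P i x y) (fun y _ => hP.nonneg i x y)
    (Finset.mem_univ _)

theorem IsSingleSite.generator_mulVec (hP : IsSingleSite P) (φ : Config n → ℝ) (x : Config n) :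
    (generator P *ᵥ φ) x = ∑ i, flipProb P i x * (φ (flipAt x i) - φ x) := by
  rw [generator, Matrix.sum_mulVec, Finset.sum_apply]
  refine Finset.sum_congr rfl fun i _ => ?_
  rw [Matrix.sub_mulVec, Matrix.one_mulVec, Pi.sub_apply, hP.mulVec_eq]
  ring

theorem IsSingleSite.generator_mulVec_of_subset (hP : IsSingleSite P) {φ : Config n → ℝ}
    {T : Finset (Fin n)} (h : ∀ m ∉ T, ∀ y, φ (flipAt y m) = φ y) (x : Config n) :
    (generator P *ᵥ φ) x = ∑ i ∈ T, flipProb P i x * (φ (flipAt x i) - φ x) := by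
  rw [hP.generator_mulVec]
  refine (Finset.sum_subset (Finset.subset_univ T) fun m _ hm => ?_).symm
  rw [h m hm, sub_self, mul_zero]

end FlipCycle

namespace FlipCycle

open scoped Matrix

/-! ### Short-time estimates -/

variable {n : ℕ} {P : Fin n → Matrix (Config n) (Config n) ℝ}

/-- A function of the configuration that depends only on the spins in `N`. -/
def IsLocal (N : Finset (Fin n)) (φ : Config n → ℝ) : Prop :=
  ∀ x y : Config n, (∀ m ∈ N, x m = y m) → φ x = φ y

/-- Only updates at `i` affect the indicator, and they come at rate `1`. -/
theorem IsSingleSite.evol_ne_le (hP : IsSingleSite P) (x : Config n) (i : Fin n) {h : ℝ}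
    (hh : 0 ≤ h) : evol P h (fun y => if y i ≠ x i then 1 else 0) x ≤ h := by
  have hgen (y : Config n) :
      (generator P *ᵥ fun y => if y i ≠ x i then (1 : ℝ) else 0) y ≤ 1 := by
    rw [hP.generator_mulVec_of_subset (T := {i}), Finset.sum_singleton]
    · have h0 := hP.flipProb_nonneg i y
      have h1 := hP.flipProb_le_one i y
      split_ifs <;> linarith
    · intro m hm y
      rw [flipAt_of_ne y (Ne.symm (by simpa using hm))]
  have := evol_le_of_deriv (P := P) (φ := fun y => if y i ≠ x i then (1 : ℝ) else 0) (x := x)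
    (K := 1) (b := 0) hh fun s hs => by
      have := hP.evol_mono hs.1 hgen x
      rw [hP.evol_const] at this
      linarith
  simpa using this

/-- The event can only be entered when one of the two spins has already changed, so the generator
applied to its indicator is at most the sum of the two single indicators, of mean at most `2s`. -/
theorem IsSingleSite.evol_ne_ne_le (hP : IsSingleSite P) (x : Config n) {i j : Fin n}
    (hij : i ≠ j) {h : ℝ} (hh : 0 ≤ h) :
    evol P h (fun y => if y i ≠ x i ∧ y j ≠ x j then 1 else 0) x ≤ h ^ 2 := by
  have hgen (y : Config n) :
      (generator P *ᵥ fun y => if y i ≠ x i ∧ y j ≠ x j then (1 : ℝ) else 0) y ≤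
        ∑ m ∈ {i, j}, if y m ≠ x m then 1 else 0 := by
    rw [hP.generator_mulVec_of_subset (T := {i, j}), Finset.sum_pair hij, Finset.sum_pair hij,
      add_comm]
    · have h0 := hP.flipProb_nonneg i y
      have h1 := hP.flipProb_le_one i y
      have h2 := hP.flipProb_nonneg j y
      have h3 := hP.flipProb_le_one j y
      rw [flipAt_of_ne y hij, flipAt_of_ne y hij.symm]
      refine add_le_add ?_ ?_ <;> split_ifs <;> simp_all <;> linarith
    · intro m hm y
      simp only [Finset.mem_insert, Finset.mem_singleton, not_or] at hm
      rw [flipAt_of_ne y (Ne.symm hm.1), flipAt_of_ne y (Ne.symm hm.2)]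
  have := evol_le_of_deriv (P := P)
    (φ := fun y => if y i ≠ x i ∧ y j ≠ x j then (1 : ℝ) else 0) (x := x)
    (K := 0) (b := 2) hh fun s hs => by
      refine (hP.evol_mono hs.1 hgen x).trans ?_
      rw [evol_sum]
      refine (Finset.sum_le_card_nsmul _ _ s fun m _ => hP.evol_ne_le x m hs.1).trans ?_
      rw [Finset.card_pair hij]
      simp
  simp only [ne_eq, not_true_eq_false, and_self, if_false] at this
  linarith

/-- The generator applied to the indicator is `flipProb P l x` at `x` and depends only on the spins
in `N`. It can therefore deviate only after one of these spins has changed, which by time `s` has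
probability at most `D * s`. -/
theorem IsSingleSite.evol_flip (hP : IsSingleSite P) {N : Finset (Fin n)} {D : ℝ} (x : Config n)
    {l o : Fin n} (hlo : l ≠ o) (hl : l ∈ N) (ho : o ∈ N) (hN : (N.card : ℝ) ≤ D)
    (hpl : IsLocal N (flipProb P l)) (hpo : IsLocal N (flipProb P o)) {h : ℝ} (hh : 0 ≤ h) :
    |evol P h (fun y => if y l ≠ x l ∧ y o = x o then 1 else 0) x - h * flipProb P l x| ≤
      2 * D * h ^ 2 := by
  set φ : Config n → ℝ := fun y => if y l ≠ x l ∧ y o = x o then 1 else 0 with hφ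
  have hgen (y : Config n) : (generator P *ᵥ φ) y =
      flipProb P l y * (φ (flipAt y l) - φ y) + flipProb P o y * (φ (flipAt y o) - φ y) := by
    rw [hP.generator_mulVec_of_subset (T := {l, o}), Finset.sum_pair hlo]
    intro m hm y
    simp only [Finset.mem_insert, Finset.mem_singleton, not_or] at hm
    simp only [hφ, flipAt_of_ne y (Ne.symm hm.1), flipAt_of_ne y (Ne.symm hm.2)]
  have hφ01 (y : Config n) : 0 ≤ φ y ∧ φ y ≤ 1 := by
    simp only [hφ]
    split_ifs <;> norm_num
  have hterm (m : Fin n) (y : Config n) :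
      |flipProb P m y * (φ (flipAt y m) - φ y)| ≤ 1 := by
    rw [abs_mul, abs_of_nonneg (hP.flipProb_nonneg m y)]
    refine mul_le_one₀ (hP.flipProb_le_one m y) (abs_nonneg _) (abs_le.2 ⟨?_, ?_⟩)
    · linarith [(hφ01 y).2, (hφ01 (flipAt y m)).1]
    · linarith [(hφ01 y).1, (hφ01 (flipAt y m)).2]
  have hgenx : (generator P *ᵥ φ) x = flipProb P l x := by
    rw [hgen]
    have h1 : φ x = 0 := by simp [hφ]
    have h2 : φ (flipAt x l) = 1 := by
      simp only [hφ, flipAt_self, flipAt_of_ne x hlo.symm]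
      exact if_pos ⟨neg_unit_ne _, trivial⟩
    have h3 : φ (flipAt x o) = 0 := by
      simp [hφ, flipAt_of_ne x hlo]
    rw [h1, h2, h3]
    ring
  -- When some spin in `N` has changed, the left side is at most `3`: two generator terms and
  -- `flipProb P l x`, each at most `1` in absolute value.
  have hdiff (y : Config n) : |(generator P *ᵥ φ) y - flipProb P l x| ≤
      (∑ m ∈ N, if y m ≠ x m then (1 : ℝ) else 0) * 4 := by
    by_cases hy : ∀ m ∈ N, y m = x m
    · have hfl (m : Fin n) : ∀ k ∈ N, flipAt y m k = flipAt x m k := by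
        intro k hk
        by_cases hkm : k = m
        · subst hkm
          rw [flipAt_self, flipAt_self, hy k hk]
        · rw [flipAt_of_ne y hkm, flipAt_of_ne x hkm, hy k hk]
      have hφy : ∀ z z' : Config n, (∀ k ∈ N, z k = z' k) → φ z = φ z' := by
        intro z z' hz
        simp only [hφ, hz l hl, hz o ho]
      have : (generator P *ᵥ φ) y = flipProb P l x := by
        rw [← hgenx, hgen, hgen, hpl y x hy, hpo y x hy, hφy y x hy, hφy _ _ (hfl l),
          hφy _ _ (hfl o)]
      rw [this, sub_self, abs_zero]
      exact mul_nonneg (Finset.sum_nonneg fun m _ => by split_ifs <;> norm_num) (by norm_num)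
    · push Not at hy
      obtain ⟨m, hm, hym⟩ := hy
      have h1 : (1 : ℝ) ≤ ∑ m ∈ N, if y m ≠ x m then (1 : ℝ) else 0 := by
        have := Finset.single_le_sum (f := fun m => if y m ≠ x m then (1 : ℝ) else 0)
          (fun k _ => by split_ifs <;> norm_num) hm
        simpa [hym] using this
      have h2 := hterm l y
      have h3 := hterm o y
      have h4 := hP.flipProb_nonneg l x
      have h5 := hP.flipProb_le_one l x
      rw [hgen, abs_le]
      rw [abs_le] at h2 h3
      constructor <;> linarith
  have hevol : ∀ s ∈ Set.Icc 0 h, |evol P s (generator P *ᵥ φ) x - flipProb P l x| ≤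
      4 * D * s := by
    intro s hs
    have h1 := hP.abs_evol_le hs.1 hdiff x
    rw [evol_sub, hP.evol_const, evol_mul_const, evol_sum] at h1
    have h2 := Finset.sum_le_card_nsmul N _ s fun m _ => hP.evol_ne_le x m hs.1
    rw [nsmul_eq_mul] at h2
    have h3 := mul_le_mul_of_nonneg_right hN hs.1
    linarith
  have hφx : φ x = 0 := by simp [hφ]
  have up := evol_le_of_deriv (P := P) (φ := φ) (x := x) (K := flipProb P l x) (b := 4 * D) hh
    fun s hs => by linarith [(abs_le.1 (hevol s hs)).2]
  have lo := le_evol_of_deriv (P := P) (φ := φ) (x := x) (K := flipProb P l x) (b := -(4 * D)) hh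
    fun s hs => by linarith [(abs_le.1 (hevol s hs)).1]
  rw [hφx] at up lo
  rw [abs_le]
  constructor <;> linarith

/-- There are three errors: replacing `φ` by `ψ` on the event that `l` changes (`h * e`), a second
change in `N` besides the one at `l` (`D * b * h ^ 2`), and the error of `evol_flip` multiplied by
`b` (`2 * D * b * h ^ 2`). -/
theorem IsSingleSite.evol_window (hP : IsSingleSite P) {N : Finset (Fin n)} {D : ℝ}
    (x : Config n) {l o : Fin n} (hlo : l ≠ o) (hl : l ∈ N) (ho : o ∈ N) (hN : (N.card : ℝ) ≤ D)
    (hpl : IsLocal N (flipProb P l)) (hpo : IsLocal N (flipProb P o)) {h : ℝ} (hh : 0 ≤ h)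
    {φ ψ : Config n → ℝ} {e b : ℝ} (hφψ : ∀ y, |φ y - ψ y| ≤ e) (hψ0 : ∀ y, 0 ≤ ψ y)
    (hψb : ∀ y, ψ y ≤ b) (hψ : IsLocal N ψ) :
    |evol P h (fun y => if y l ≠ x l ∧ y o = x o then φ y else 0) x -
      h * flipProb P l x * ψ (flipAt x l)| ≤ h * e + 3 * D * b * h ^ 2 := by
  have he : 0 ≤ e := (abs_nonneg _).trans (hφψ x)
  have hb : 0 ≤ b := (hψ0 x).trans (hψb x)
  have hdiff (y : Config n) :
      |(if y l ≠ x l ∧ y o = x o then φ y else 0) -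
        (if y l ≠ x l ∧ y o = x o then (1 : ℝ) else 0) * ψ (flipAt x l)| ≤
      (if y l ≠ x l then (1 : ℝ) else 0) * e +
        (∑ m ∈ N.erase l, if y l ≠ x l ∧ y m ≠ x m then (1 : ℝ) else 0) * b := by
    have hs0 : 0 ≤ ∑ m ∈ N.erase l, if y l ≠ x l ∧ y m ≠ x m then (1 : ℝ) else 0 :=
      Finset.sum_nonneg fun m _ => by split_ifs <;> norm_num
    by_cases hp : y l ≠ x l ∧ y o = x o
    · rw [if_pos hp, if_pos hp, if_pos hp.1, one_mul, one_mul]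
      have h1 : |ψ y - ψ (flipAt x l)| ≤
          (∑ m ∈ N.erase l, if y l ≠ x l ∧ y m ≠ x m then (1 : ℝ) else 0) * b := by
        by_cases hy : ∀ m ∈ N.erase l, y m = x m
        · have : ψ y = ψ (flipAt x l) := by
            refine hψ _ _ fun m hm => ?_
            by_cases hml : m = l
            · subst hml
              rw [flipAt_self]
              exact Int.units_ne_iff_eq_neg.1 hp.1
            · rw [flipAt_of_ne x hml, hy m (Finset.mem_erase.2 ⟨hml, hm⟩)]
          rw [this, sub_self, abs_zero]
          exact mul_nonneg hs0 hb
        · push Not at hy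
          obtain ⟨m, hm, hym⟩ := hy
          have h1 : (1 : ℝ) ≤
              ∑ m ∈ N.erase l, if y l ≠ x l ∧ y m ≠ x m then (1 : ℝ) else 0 := by
            have := Finset.single_le_sum
              (f := fun m => if y l ≠ x l ∧ y m ≠ x m then (1 : ℝ) else 0)
              (fun k _ => by split_ifs <;> norm_num) hm
            simpa [hym, hp.1] using this
          refine le_trans ?_ (le_mul_of_one_le_left hb h1)
          rw [abs_le]
          constructor <;> linarith [hψ0 y, hψb y, hψ0 (flipAt x l), hψb (flipAt x l)]
      calc |φ y - ψ (flipAt x l)| ≤ |φ y - ψ y| + |ψ y - ψ (flipAt x l)| := abs_sub_le _ _ _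
        _ ≤ _ := add_le_add (hφψ y) h1
    · rw [if_neg hp, if_neg hp, zero_mul, sub_zero, abs_zero]
      refine add_nonneg (mul_nonneg ?_ he) (mul_nonneg hs0 hb)
      split_ifs <;> norm_num
  have h1 := hP.abs_evol_le hh hdiff x
  rw [evol_sub, evol_mul_const] at h1
  have h2 : evol P h (fun y => (if y l ≠ x l then (1 : ℝ) else 0) * e +
      (∑ m ∈ N.erase l, if y l ≠ x l ∧ y m ≠ x m then (1 : ℝ) else 0) * b) x ≤
      h * e + D * h ^ 2 * b := by
    have hadd : evol P h (fun y => (if y l ≠ x l then (1 : ℝ) else 0) * e +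
        (∑ m ∈ N.erase l, if y l ≠ x l ∧ y m ≠ x m then (1 : ℝ) else 0) * b) x =
        evol P h (fun y => (if y l ≠ x l then (1 : ℝ) else 0) * e) x + evol P h (fun y =>
        (∑ m ∈ N.erase l, if y l ≠ x l ∧ y m ≠ x m then (1 : ℝ) else 0) * b) x :=
      congrFun (Matrix.mulVec_add (semigroup P h) _ _) x
    rw [hadd, evol_mul_const, evol_mul_const, evol_sum]
    have hs := Finset.sum_le_card_nsmul (N.erase l) _ (h ^ 2) fun m hm =>
      hP.evol_ne_ne_le x (Finset.ne_of_mem_erase hm).symm hh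
    rw [nsmul_eq_mul] at hs
    have hc : ((N.erase l).card : ℝ) ≤ D :=
      le_trans (by exact_mod_cast Finset.card_le_card (Finset.erase_subset l N)) hN
    exact add_le_add (mul_le_mul_of_nonneg_right (hP.evol_ne_le x l hh) he)
      (mul_le_mul_of_nonneg_right
        (hs.trans (mul_le_mul_of_nonneg_right hc (sq_nonneg h))) hb)
  have h3 := hP.evol_flip x hlo hl ho hN hpl hpo hh
  have h4 := mul_le_mul h3 (hψb (flipAt x l)) (hψ0 _) ((abs_nonneg _).trans h3)
  rw [← abs_of_nonneg (hψ0 (flipAt x l)), ← abs_mul, sub_mul] at h4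
  refine (abs_sub_le _ _ _).trans ((add_le_add (h1.trans h2) h4).trans ?_)
  linarith

/-! ### Sequences of windows -/

/-- From `x` to `y`, the spin of `l` changes and the spins of the other sites of the pair
`{i, j}` do not. -/
def FlipsOnly (i j l : Fin n) (x y : Config n) : Prop :=
  ∀ s : Fin n, s = i ∨ s = j → (y s ≠ x s ↔ s = l)

theorem flipsOnly_iff {i j l o : Fin n} (hlo : l ≠ o) (h : (l = i ∧ o = j) ∨ (l = j ∧ o = i))
    (x y : Config n) : FlipsOnly i j l x y ↔ y l ≠ x l ∧ y o = x o := by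
  constructor
  · intro H
    refine ⟨(H l (by tauto)).2 rfl, ?_⟩
    by_contra hne
    exact hlo.symm ((H o (by tauto)).1 hne)
  · rintro ⟨h1, h2⟩ s hs
    have hs' : s = l ∨ s = o := by
      rcases h with ⟨rfl, rfl⟩ | ⟨rfl, rfl⟩ <;> tauto
    rcases hs' with rfl | rfl
    · exact ⟨fun _ => rfl, fun _ => h1⟩
    · exact ⟨fun h3 => absurd h2 h3, fun h3 => absurd h3.symm hlo⟩

open Classical in
/-- The probability that, started from `x`, the sites of the sequence `l` are the ones that
change in successive windows of length `ε`. -/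
noncomputable def windowProb (P : Fin n → Matrix (Config n) (Config n) ℝ) (i j : Fin n) (ε : ℝ) :
    (m : ℕ) → (Fin m → Fin n) → Config n → ℝ
  | 0, _, _ => 1
  | m + 1, l, x => evol P ε (fun y =>
      if FlipsOnly i j (l 0) x y then windowProb P i j ε m (Fin.tail l) y else 0) x

/-- The product of the flip probabilities along a sequence of sites. -/
def flipProd (P : Fin n → Matrix (Config n) (Config n) ℝ) : (m : ℕ) → (Fin m → Fin n) →
    Config n → ℝ
  | 0, _, _ => 1
  | m + 1, l, x => flipProb P (l 0) x * flipProd P m (Fin.tail l) (flipAt x (l 0))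

theorem IsSingleSite.flipProd_mem (hP : IsSingleSite P) :
    ∀ (m : ℕ) (l : Fin m → Fin n) (x : Config n),
      0 ≤ flipProd P m l x ∧ flipProd P m l x ≤ 1
  | 0, _, _ => by simp [flipProd]
  | m + 1, l, x => by
    have h := hP.flipProd_mem m (Fin.tail l) (flipAt x (l 0))
    exact ⟨mul_nonneg (hP.flipProb_nonneg _ _) h.1,
      mul_le_one₀ (hP.flipProb_le_one _ _) h.1 h.2⟩

theorem flipProd_local {N : Finset (Fin n)} : ∀ (m : ℕ) (l : Fin m → Fin n),
    (∀ k, IsLocal N (flipProb P (l k))) → IsLocal N (flipProd P m l)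
  | 0, _, _ => fun _ _ _ => rfl
  | m + 1, l, hl => fun x y hxy => by
    simp only [flipProd]
    rw [hl 0 x y hxy, flipProd_local m (Fin.tail l) (fun k => hl k.succ) (flipAt x (l 0))
      (flipAt y (l 0)) fun k hk => ?_]
    by_cases h : k = l 0
    · rw [h, flipAt_self, flipAt_self, hxy _ (h ▸ hk)]
    · rw [flipAt_of_ne x h, flipAt_of_ne y h, hxy k hk]

/-- Induction over the first window by `evol_window` with `b = ε ^ m`: each window adds `3 * D` to
the coefficient of the error. -/
theorem IsSingleSite.windowProb_sub_le (hP : IsSingleSite P) {N : Finset (Fin n)} {D : ℝ}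
    {i j : Fin n} (hij : i ≠ j) (hi : i ∈ N) (hj : j ∈ N) (hN : (N.card : ℝ) ≤ D)
    (hpi : IsLocal N (flipProb P i)) (hpj : IsLocal N (flipProb P j)) {ε : ℝ} (hε : 0 ≤ ε) :
    ∀ (m : ℕ) (l : Fin m → Fin n), (∀ k, l k = i ∨ l k = j) → ∀ x,
      |windowProb P i j ε m l x - ε ^ m * flipProd P m l x| ≤ 3 * m * D * ε ^ (m + 1)
  | 0, _, _, x => by simp [windowProb, flipProd]
  | m + 1, l, hl, x => by
    classical
    obtain ⟨o, hlo, ho⟩ : ∃ o, l 0 ≠ o ∧ ((l 0 = i ∧ o = j) ∨ (l 0 = j ∧ o = i)) := by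
      rcases hl 0 with h | h
      · exact ⟨j, h ▸ hij, Or.inl ⟨h, rfl⟩⟩
      · exact ⟨i, h ▸ hij.symm, Or.inr ⟨h, rfl⟩⟩
    have hloc (k) : IsLocal N (flipProb P (l k)) := by
      rcases hl k with h | h <;> rw [h] <;> assumption
    have hmem : l 0 ∈ N ∧ o ∈ N ∧ IsLocal N (flipProb P o) := by
      rcases ho with ⟨h, rfl⟩ | ⟨h, rfl⟩ <;> rw [h] <;> exact ⟨‹_›, ‹_›, ‹_›⟩
    have hψ := flipProd_local m (Fin.tail l) fun k => hloc k.succ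
    have key := hP.evol_window x hlo hmem.1 hmem.2.1 hN (hloc 0) hmem.2.2 hε
      (φ := windowProb P i j ε m (Fin.tail l))
      (ψ := fun y => ε ^ m * flipProd P m (Fin.tail l) y) (b := ε ^ m)
      (fun y => hP.windowProb_sub_le hij hi hj hN hpi hpj hε m (Fin.tail l)
        (fun k => hl k.succ) y)
      (fun y => mul_nonneg (pow_nonneg hε m) (hP.flipProd_mem m _ y).1)
      (fun y => mul_le_of_le_one_right (pow_nonneg hε m) (hP.flipProd_mem m _ y).2)
      (fun y z hyz => by simp only [hψ y z hyz])
    have h1 : windowProb P i j ε (m + 1) l x = evol P ε (fun y =>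
        if y (l 0) ≠ x (l 0) ∧ y o = x o then windowProb P i j ε m (Fin.tail l) y else 0) x := by
      rw [windowProb]
      congr 1
      funext y
      simp only [flipsOnly_iff hlo ho]
    rw [h1, flipProd]
    have h2 : ε ^ (m + 1) * (flipProb P (l 0) x * flipProd P m (Fin.tail l) (flipAt x (l 0))) =
        ε * flipProb P (l 0) x * (ε ^ m * flipProd P m (Fin.tail l) (flipAt x (l 0))) := by
      ring
    rw [h2]
    refine key.trans (le_of_eq ?_)
    push_cast
    ring

end FlipCycle

namespace FlipCycle

/-! ### Ising models -/

variable {n : ℕ} {A : Matrix (Fin n) (Fin n) ℝ} {h : Fin n → ℝ} {d : ℕ} {lam α : ℝ}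
  {P : Fin n → Matrix (Config n) (Config n) ℝ} {f : Fin n → ℝ → ℝ} {δ₀ : ℝ} {η : ℝ → ℝ} {γ κ : ℝ}

/-- If two configurations agree at `i` and its neighbours, the exponent in `γ`-boundedness vanishes;
applying the bound in both directions gives equality. -/
theorem IsBounded.isLocal_flipProb (hb : IsBounded A P γ) {N : Finset (Fin n)} {i : Fin n}
    (hi : i ∈ N) (hN : ∀ m, Adj A i m → m ∈ N) : IsLocal N (flipProb P i) := by
  have key (x y : Config n) (hxy : ∀ m ∈ N, x m = y m) : flipProb P i x ≤ flipProb P i y := by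
    have h1 := hb i x y (-x i) (hxy i hi)
    have h2 : ∑ k ∈ Finset.univ.filter (fun k => x k ≠ y k), |A i k| = 0 := by
      refine Finset.sum_eq_zero fun k hk => abs_eq_zero.2 ?_
      by_contra hA
      refine (Finset.mem_filter.1 hk).2 ?_
      by_cases hik : i = k
      · exact hik ▸ hxy i hi
      · exact hxy k (hN k ⟨hik, hA⟩)
    rw [h2, mul_zero, Real.exp_zero, one_mul] at h1
    unfold flipProb flipAt
    rwa [← hxy i hi]
  exact fun x y hxy => le_antisymm (key x y hxy) (key y x fun m hm => (hxy m hm).symm)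

open Classical in
/-- The sites `i`, `j` and their neighbours. -/
noncomputable def pairNbhd (A : Matrix (Fin n) (Fin n) ℝ) (i j : Fin n) : Finset (Fin n) :=
  Finset.univ.filter fun m => (m = i ∨ m = j) ∨ Adj A i m ∨ Adj A j m

theorem IsingAssumption.card_pairNbhd_le (hA : IsingAssumption A h d lam α) (i j : Fin n) :
    ((pairNbhd A i j).card : ℝ) ≤ 4 * d := by
  have h1 : (pairNbhd A i j : Set (Fin n)) = ({i, j} : Set (Fin n)) ∪
      ({m | Adj A i m} ∪ {m | Adj A j m}) := by
    ext m
    simp [pairNbhd]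
  have h2 : (pairNbhd A i j).card ≤ 2 + (d + d) := by
    rw [← Set.ncard_coe_finset, h1]
    refine (Set.ncard_union_le _ _).trans (add_le_add ((Set.ncard_insert_le i {j}).trans (by simp)) ?_)
    exact (Set.ncard_union_le _ _).trans (add_le_add (hA.degree i) (hA.degree j))
  have h3 := hA.d_pos
  have h4 : (pairNbhd A i j).card ≤ 4 * d := by omega
  exact_mod_cast h4

theorem flipAt_setSpin (x : Config n) (i : Fin n) (a : ℤˣ) :
    flipAt (setSpin x i a) i = setSpin x i (-a) := by
  simp [flipAt, setSpin]

theorem ising_pos (A : Matrix (Fin n) (Fin n) ℝ) (h : Fin n → ℝ) (x : Config n) :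
    0 < ising A h x :=
  div_pos (Real.exp_pos _) (Finset.sum_pos (fun _ _ => Real.exp_pos _) Finset.univ_nonempty)

/-- In `f² / r = f · (f / r)` the factor `f` is the probability of flipping up, and detailed balance
identifies `f / r` with that of flipping down. The product is symmetric, so the current sign of the
spin is irrelevant. -/
theorem gfun_ratio (hrev : IsReversible (ising A h) P) (hcon : IsSiteConsistent (ising A h) P f)
    (i : Fin n) (x : Config n) :
    gfun (f i) (ratio (ising A h) i x) = flipProb P i x * flipProb P i (flipAt x i) := by
  have hm : flipProb P i (setSpin x i (-1)) = f i (ratio (ising A h) i x) := by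
    rw [flipProb, flipAt_setSpin, neg_neg, hcon.eq]
  have hr := hrev i (setSpin x i (-1))
  rw [flipAt_setSpin, neg_neg] at hr
  have hp : P i (setSpin x i 1) (setSpin x i (-1)) = flipProb P i (setSpin x i 1) := by
    rw [flipProb, flipAt_setSpin]
  have hm' : P i (setSpin x i (-1)) (setSpin x i 1) = flipProb P i (setSpin x i (-1)) := by
    rw [flipProb, flipAt_setSpin, neg_neg]
  rw [hp, hm'] at hr
  have h1 := (ising_pos A h (setSpin x i 1)).ne'
  have h2 := (ising_pos A h (setSpin x i (-1))).ne'
  have key : gfun (f i) (ratio (ising A h) i x) =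
      flipProb P i (setSpin x i (-1)) * flipProb P i (setSpin x i 1) := by
    rw [gfun, ← hm, ratio]
    field_simp
    linear_combination flipProb P i (setSpin x i (-1)) * hr
  rw [key]
  rcases Int.units_eq_one_or (x i) with hx | hx
  · have e1 : setSpin x i 1 = x := by rw [← hx]; simp [setSpin]
    have e2 : flipAt x i = setSpin x i (-1) := by rw [flipAt, hx]
    rw [e2, e1, mul_comm]
  · have e1 : setSpin x i (-1) = x := by rw [← hx]; simp [setSpin]
    have e2 : flipAt x i = setSpin x i 1 := by rw [flipAt, hx, neg_neg]
    rw [e2, e1]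

/-- The field acting on the spin at `i`. -/
noncomputable def localField (A : Matrix (Fin n) (Fin n) ℝ) (h : Fin n → ℝ) (i : Fin n)
    (x : Config n) : ℝ := (∑ k ∈ Finset.univ.erase i, A i k * spin x k) + h i

theorem spin_setSpin_self (x : Config n) (i : Fin n) (a : ℤˣ) :
    spin (setSpin x i a) i = ((a : ℤ) : ℝ) := by simp [spin, setSpin]

theorem spin_setSpin_of_ne (x : Config n) {i k : Fin n} (hk : k ≠ i) (a : ℤˣ) :
    spin (setSpin x i a) k = spin x k := by simp [spin, setSpin, hk]

theorem abs_spin (x : Config n) (i : Fin n) : |spin x i| = 1 := by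
  rcases Int.units_eq_one_or (x i) with hx | hx <;> simp [spin, hx]

theorem spin_flipAt_self (x : Config n) (i : Fin n) : spin (flipAt x i) i = -spin x i := by
  simp [spin, flipAt_self]

theorem spin_flipAt_of_ne (x : Config n) {i k : Fin n} (hk : k ≠ i) :
    spin (flipAt x i) k = spin x k := by simp [spin, flipAt_of_ne x hk]

theorem weight_setSpin (hA : A.IsSymm) (h : Fin n → ℝ) (i : Fin n) (x : Config n) :
    ∃ c : ℝ, ∀ a : ℤˣ, weight A h (setSpin x i a) =
      Real.exp (((a : ℤ) : ℝ) * localField A h i x + c) := by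
  refine ⟨(1 / 2) * (A i i + ∑ k ∈ Finset.univ.erase i, ∑ l ∈ Finset.univ.erase i,
    spin x k * A k l * spin x l) + ∑ k ∈ Finset.univ.erase i, h k * spin x k, fun a => ?_⟩
  have ha : ((a : ℤ) : ℝ) * ((a : ℤ) : ℝ) = 1 := by
    rcases Int.units_eq_one_or a with rfl | rfl <;> simp
  have hne : ∀ k ∈ Finset.univ.erase i, spin (setSpin x i a) k = spin x k := fun k hk =>
    spin_setSpin_of_ne x (Finset.ne_of_mem_erase hk) a
  have h1 : ∑ k, h k * spin (setSpin x i a) k =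
      h i * a + ∑ k ∈ Finset.univ.erase i, h k * spin x k := by
    rw [← Finset.add_sum_erase _ _ (Finset.mem_univ i), spin_setSpin_self]
    congr 1
    exact Finset.sum_congr rfl fun k hk => by rw [hne k hk]
  have h2 (k : Fin n) : ∑ l, spin (setSpin x i a) k * A k l * spin (setSpin x i a) l =
      spin (setSpin x i a) k * A k i * a +
        ∑ l ∈ Finset.univ.erase i, spin (setSpin x i a) k * A k l * spin x l := by
    rw [← Finset.add_sum_erase _ _ (Finset.mem_univ i), spin_setSpin_self]
    congr 1
    exact Finset.sum_congr rfl fun l hl => by rw [hne l hl]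
  have h3 : ∑ k, ∑ l, spin (setSpin x i a) k * A k l * spin (setSpin x i a) l =
      A i i + a * (∑ l ∈ Finset.univ.erase i, A i l * spin x l) +
        (a * (∑ k ∈ Finset.univ.erase i, A i k * spin x k) +
        ∑ k ∈ Finset.univ.erase i, ∑ l ∈ Finset.univ.erase i, spin x k * A k l * spin x l) := by
    rw [← Finset.add_sum_erase _ _ (Finset.mem_univ i), h2, spin_setSpin_self]
    congr 1
    · rw [Finset.mul_sum]
      congr 1
      · linear_combination A i i * ha
      · exact Finset.sum_congr rfl fun l _ => by ring
    · rw [Finset.mul_sum, ← Finset.sum_add_distrib]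
      refine Finset.sum_congr rfl fun k hk => ?_
      rw [h2, hne k hk, hA.apply i k]
      ring
  rw [weight, h1, h3, localField]
  congr 1
  ring

theorem ratio_ising (hA : A.IsSymm) (h : Fin n → ℝ) (i : Fin n) (x : Config n) :
    ratio (ising A h) i x = Real.exp (2 * localField A h i x) := by
  obtain ⟨c, hc⟩ := weight_setSpin hA h i x
  have hZ : (∑ y, weight A h y) ≠ 0 :=
    (Finset.sum_pos (fun _ _ => Real.exp_pos _) Finset.univ_nonempty).ne'
  rw [ratio, ising, ising, div_div_div_cancel_right₀ hZ, hc, hc, ← Real.exp_sub]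
  congr 1
  push_cast
  ring

theorem localField_flipAt (A : Matrix (Fin n) (Fin n) ℝ) (h : Fin n → ℝ) {i k : Fin n}
    (hk : k ≠ i) (x : Config n) :
    localField A h i (flipAt x k) = localField A h i x - 2 * (A i k * spin x k) := by
  have hmem : k ∈ Finset.univ.erase i := Finset.mem_erase.2 ⟨hk, Finset.mem_univ k⟩
  have h1 : ∑ m ∈ (Finset.univ.erase i).erase k, A i m * spin (flipAt x k) m =
      ∑ m ∈ (Finset.univ.erase i).erase k, A i m * spin x m :=
    Finset.sum_congr rfl fun m hm => by rw [spin_flipAt_of_ne x (Finset.ne_of_mem_erase hm)]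
  rw [localField, localField, ← Finset.add_sum_erase _ _ hmem, h1, spin_flipAt_self,
    ← Finset.add_sum_erase _ (fun m => A i m * spin x m) hmem]
  ring

theorem ratio_flipAt_of_not_adj (hA : A.IsSymm) (h : Fin n → ℝ) {i j : Fin n} (hij : i ≠ j)
    (hadj : ¬ Adj A i j) (x : Config n) :
    ratio (ising A h) i (flipAt x j) = ratio (ising A h) i x := by
  have : A i j = 0 := by
    by_contra hne
    exact hadj ⟨hij, hne⟩
  rw [ratio_ising hA, ratio_ising hA, localField_flipAt A h hij.symm, this]
  simp

/-- The coupling to `j` is reserved within the width, so that both ratios, with either spin at `j`,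
lie in the range where stability applies. -/
theorem IsingAssumption.abs_localField_sub_le (hA : IsingAssumption A h d lam α) {i j : Fin n}
    (hij : i ≠ j) (x : Config n) :
    |localField A h i x - A i j * spin x j| + |A i j| ≤ lam := by
  have hmem : j ∈ Finset.univ.erase i := Finset.mem_erase.2 ⟨hij.symm, Finset.mem_univ j⟩
  have hw := hA.width i
  rw [← Finset.add_sum_erase _ _ hmem] at hw
  have h1 : |localField A h i x - A i j * spin x j| ≤
      ∑ m ∈ (Finset.univ.erase i).erase j, |A i m| + |h i| := by
    rw [localField, ← Finset.add_sum_erase _ _ hmem, add_assoc, add_sub_cancel_left]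
    refine (abs_add_le _ _).trans (add_le_add_left ?_ _)
    refine (Finset.abs_sum_le_sum_abs _ _).trans (Finset.sum_le_sum fun m _ => ?_)
    rw [abs_mul, abs_spin, mul_one]
  linarith

theorem exp_mul_le_abs_exp_sub {s t m b : ℝ} (hs : m ≤ s) (ht : m ≤ t) (hb : b ≤ |s - t|) :
    Real.exp m * b ≤ |Real.exp s - Real.exp t| := by
  wlog hst : t ≤ s generalizing s t
  · rw [abs_sub_comm]
    exact this ht hs (by rwa [abs_sub_comm]) (le_of_not_ge hst)
  rw [abs_of_nonneg (sub_nonneg.2 hst)] at hb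
  have h1 : Real.exp s = Real.exp t * Real.exp (s - t) := by
    rw [← Real.exp_add]
    ring_nf
  have h2 := Real.add_one_le_exp (s - t)
  have h3 : Real.exp m ≤ Real.exp t := Real.exp_le_exp.2 ht
  calc Real.exp m * b ≤ Real.exp m * (s - t) := by gcongr
    _ ≤ Real.exp t * (s - t) := mul_le_mul_of_nonneg_right h3 (sub_nonneg.2 hst)
    _ ≤ Real.exp s - Real.exp t := by
      rw [h1]
      nlinarith [Real.exp_pos t]
    _ ≤ _ := le_abs_self _

/-- The difference of `g_i` between `x` and `x` with the spin at `j` flipped. -/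
noncomputable def gdiff (A : Matrix (Fin n) (Fin n) ℝ) (h : Fin n → ℝ) (f : Fin n → ℝ → ℝ)
    (i j : Fin n) (x : Config n) : ℝ :=
  gfun (f i) (ratio (ising A h) i x) - gfun (f i) (ratio (ising A h) i (flipAt x j))

/-- The ratios at `x` and `x^{⊕j}` are, in some order, `z` and `exp(4|A_ij|) z`, with `z` the
smaller one. The absolute value hides the order, and the form is the one required by stability. -/
theorem exists_abs_gdiff_eq (hA : A.IsSymm) {i j : Fin n} (hij : i ≠ j) (x : Config n) :
    |gdiff A h f i j x| =
      |gfun (f i) (Real.exp (2 * (localField A h i x - A i j * spin x j) - 2 * |A i j|)) -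
        gfun (f i) (Real.exp (4 * |A i j|) *
          Real.exp (2 * (localField A h i x - A i j * spin x j) - 2 * |A i j|))| := by
  rw [gdiff, ratio_ising hA, ratio_ising hA, localField_flipAt A h hij.symm, ← Real.exp_add]
  have habs : |A i j * spin x j| = |A i j| := by rw [abs_mul, abs_spin, mul_one]
  rw [← habs]
  rcases abs_cases (A i j * spin x j) with ⟨hc, _⟩ | ⟨hc, _⟩
  · rw [hc, abs_sub_comm]
    congr 4 <;> ring
  · rw [hc]
    congr 4 <;> ring

/-- By stability, at least one of two configurations that differ at a further neighbour of `i`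
distinguishes the values of the spin at `j`. -/
theorem lt_abs_gdiff_or (hA : IsingAssumption A h d lam α)
    (hs : IsStable f lam α δ₀ η) {i j k : Fin n} (hij : Adj A i j) (hik : Adj A i k) (hkj : k ≠ j)
    {δ : ℝ} (hδ0 : 0 < δ) (hδ1 : δ ≤ 1) (hδ : δ ≤ δ₀)
    (hη : η δ ≤ α * Real.exp (-(2 * lam))) (x : Config n) :
    δ < |gdiff A h f i j x| ∨ δ < |gdiff A h f i j (flipAt x k)| := by
  by_contra! hcon
  have hα := hA.α_pos
  have hAij := hA.nondegenerate i j hij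
  have hAik := hA.nondegenerate i k hik
  -- The same `zs` serves both configurations, since the factor `exp(4|A_ij|)` depends on neither.
  obtain ⟨zs, _, _, hst⟩ := hs.stable i (4 * |A i j|) (by linarith)
  have hrange (y : Config n) :
      -(2 * lam) ≤ 2 * (localField A h i y - A i j * spin y j) - 2 * |A i j| ∧
      2 * (localField A h i y - A i j * spin y j) - 2 * |A i j| ≤ 2 * lam := by
    have h1 := hA.abs_localField_sub_le hij.1 y
    have h2 := abs_le.1 (le_refl |localField A h i y - A i j * spin y j|)
    have h3 := abs_nonneg (A i j)
    constructor <;> linarith [h2.1, h2.2]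
  have hclose (y : Config n) (hy : |gdiff A h f i j y| ≤ δ) :
      |zs - Real.exp (2 * (localField A h i y - A i j * spin y j) - 2 * |A i j|)| ≤ η δ := by
    rw [exists_abs_gdiff_eq hA.symm hij.1] at hy
    exact hst δ ⟨hδ0.le, hδ1⟩ hδ _ ⟨Real.exp_le_exp.2 (hrange y).1,
      Real.exp_le_exp.2 (hrange y).2⟩ hy
  have h1 := hclose x hcon.1
  have h2 := hclose _ hcon.2
  -- Flipping `k` shifts the exponent by `4|A_ik| ≥ 4α`, and the exponential has slope at least
  -- `exp(-2 lam)` on the range of the exponents.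
  have h3 := exp_mul_le_abs_exp_sub (b := 4 * α) (hrange x).1 (hrange (flipAt x k)).1 (by
    rw [localField_flipAt A h hik.1.symm, spin_flipAt_of_ne x hkj.symm]
    have : |4 * (A i k * spin x k)| = 4 * |A i k| := by
      rw [abs_mul, abs_mul, abs_spin, mul_one]
      norm_num
    calc 4 * α ≤ |4 * (A i k * spin x k)| := by rw [this]; linarith
      _ = _ := by congr 1; ring)
  have h4 := abs_sub_le (Real.exp (2 * (localField A h i x - A i j * spin x j) - 2 * |A i j|)) zs
    (Real.exp (2 * (localField A h i (flipAt x k) - A i j * spin (flipAt x k) j) - 2 * |A i j|))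
  rw [abs_sub_comm _ zs] at h4
  -- The distance is at least `4α exp(-2 lam)`, but through `zs` it is at most `2 η(δ) ≤ 2α exp(-2
  -- lam)`.
  nlinarith [mul_pos hα (Real.exp_pos (-(2 * lam)))]

/-- The combination of flip probabilities along the three cycles. -/
theorem flipProd_cycles (hrev : IsReversible (ising A h) P)
    (hcon : IsSiteConsistent (ising A h) P f) (i j : Fin n) (x : Config n) :
    flipProd P 8 ![i, i, j, j, i, i, j, j] x - 2 * flipProd P 8 ![i, i, j, j, j, i, i, j] x +
      flipProd P 8 ![j, i, i, j, j, i, i, j] x =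
    gfun (f j) (ratio (ising A h) j x) ^ 2 * gdiff A h f i j x ^ 2 := by
  rw [gdiff, gfun_ratio hrev hcon, gfun_ratio hrev hcon, gfun_ratio hrev hcon]
  -- After double flips cancel, only four flip probabilities at the pair remain in each product
  -- beside those of `i` at `x^{⊕j}`, and the identity is that of a perfect square.
  simp only [flipProd, Fin.tail, Matrix.cons_val_zero, Matrix.cons_val_succ, flipAt_flipAt]
  ring

end FlipCycle

namespace FlipCycle

open scoped Matrix

/-! ### Anticoncentration at a site over unit time -/

variable {n : ℕ} {A : Matrix (Fin n) (Fin n) ℝ} {h : Fin n → ℝ} {d : ℕ} {lam α : ℝ}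
  {P : Fin n → Matrix (Config n) (Config n) ℝ} {γ κ : ℝ}

/-- The updates at all sites but `k`. -/
def offSum (P : Fin n → Matrix (Config n) (Config n) ℝ) (k : Fin n) :
    Matrix (Config n) (Config n) ℝ := ∑ m ∈ Finset.univ.erase k, P m

/-- The updates at all sites but `k`, damped by the influence of the spin at `k`. -/
noncomputable def dampedSum (A : Matrix (Fin n) (Fin n) ℝ)
    (P : Fin n → Matrix (Config n) (Config n) ℝ) (γ : ℝ) (k : Fin n) :
    Matrix (Config n) (Config n) ℝ :=
  ∑ m ∈ Finset.univ.erase k, Real.exp (-(γ * |A m k|)) • P m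

theorem flipAt_setSpin_comm (x : Config n) {m k : Fin n} (hmk : m ≠ k) (a : ℤˣ) :
    flipAt (setSpin x m a) k = setSpin (flipAt x k) m a := by
  funext l
  by_cases hl : l = k
  · subst hl
    simp [flipAt, setSpin, hmk.symm]
  · by_cases hlm : l = m
    · subst hlm
      simp [flipAt, setSpin, hl]
    · simp [flipAt, setSpin, hl, hlm]

/-- `γ`-boundedness for two configurations that differ only at `k`: an update at `m ≠ k` keeps at
least the fraction `exp(-γ|A_mk|)` of its probability when the spin at `k` is flipped. -/
theorem damped_le (hP : IsSingleSite P) (hb : IsBounded A P γ) {m k : Fin n} (hmk : m ≠ k)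
    (x y : Config n) :
    Real.exp (-(γ * |A m k|)) * P m x y ≤ P m (flipAt x k) (flipAt y k) := by
  have key (a : ℤˣ) : Real.exp (-(γ * |A m k|)) * P m x (setSpin x m a) ≤
      P m (flipAt x k) (flipAt (setSpin x m a) k) := by
    have h1 := hb m x (flipAt x k) a (flipAt_of_ne x hmk).symm
    have h2 : Finset.univ.filter (fun l => x l ≠ flipAt x k l) = {k} := by
      ext l
      simp only [Finset.mem_filter, Finset.mem_univ, true_and, Finset.mem_singleton]
      refine ⟨fun hl => ?_, ?_⟩
      · by_contra hlk
        exact hl (flipAt_of_ne x hlk).symm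
      · rintro rfl
        rw [flipAt_self]
        exact (neg_unit_ne _).symm
    rw [h2, Finset.sum_singleton, ← flipAt_setSpin_comm x hmk] at h1
    rw [Real.exp_neg]
    exact (inv_mul_le_iff₀ (Real.exp_pos _)).2 h1
  by_cases hy : y = x
  · subst hy
    have := key (y m)
    rwa [setSpin, Function.update_eq_self] at this
  · by_cases hy' : y = flipAt x m
    · exact hy' ▸ key (-x m)
    · rw [hP.support m x y hy hy', mul_zero]
      exact hP.nonneg _ _ _

theorem offSum_nonneg (hP : IsSingleSite P) (k : Fin n) (x y : Config n) :
    0 ≤ offSum P k x y := by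
  rw [offSum, Matrix.sum_apply]
  exact Finset.sum_nonneg fun m _ => hP.nonneg m x y

theorem dampedSum_nonneg (hP : IsSingleSite P) (k : Fin n) (x y : Config n) :
    0 ≤ dampedSum A P γ k x y := by
  rw [dampedSum, Matrix.sum_apply]
  exact Finset.sum_nonneg fun m _ => mul_nonneg (Real.exp_nonneg _) (hP.nonneg m x y)

theorem dampedSum_le_offSum (hP : IsSingleSite P) (hγ : 0 ≤ γ) (k : Fin n) (x y : Config n) :
    dampedSum A P γ k x y ≤ offSum P k x y := by
  rw [dampedSum, offSum, Matrix.sum_apply, Matrix.sum_apply]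
  refine Finset.sum_le_sum fun m _ => mul_le_of_le_one_left (hP.nonneg m x y) ?_
  rw [Real.exp_le_one_iff, neg_nonpos]
  positivity

theorem offSum_row_sum (hP : IsSingleSite P) (k : Fin n) (x : Config n) :
    ∑ y, offSum P k x y = (Finset.univ.erase k).card := by
  have := hP.row_sum (Finset.univ.erase k) 1 x
  rwa [one_smul, one_mul] at this

theorem dampedSum_flip_le (hP : IsSingleSite P) (hb : IsBounded A P γ) (k : Fin n)
    (x y : Config n) : dampedSum A P γ k x y ≤ offSum P k (flipAt x k) (flipAt y k) := by
  rw [dampedSum, offSum, Matrix.sum_apply, Matrix.sum_apply]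
  exact Finset.sum_le_sum fun m hm => damped_le hP hb (Finset.ne_of_mem_erase hm) x y

/-- Every word of updates off `k`, run from `x^{⊕k}`, is compared letter by letter with the same
word run from `x`, with the flip at `k` carried along to the end. -/
theorem dampedSum_pow_le (hP : IsSingleSite P) (hb : IsBounded A P γ) (k : Fin n)
    {φ : Config n → ℝ} (hφ : ∀ x, 0 ≤ φ x) (N : ℕ) (x : Config n) :
    ((dampedSum A P γ k ^ N) *ᵥ fun y => φ (flipAt y k)) x ≤
      ((offSum P k ^ N) *ᵥ φ) (flipAt x k) := by
  induction N generalizing x with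
  | zero => simp
  | succ N ih =>
    rw [pow_succ', pow_succ', ← Matrix.mulVec_mulVec, ← Matrix.mulVec_mulVec]
    refine (mulVec_mono (dampedSum_nonneg hP k) ih x).trans ?_
    rw [Matrix.mulVec, dotProduct, Matrix.mulVec, dotProduct]
    refine le_trans ?_ (le_of_eq (Equiv.sum_comp
      (Function.Involutive.toPerm (fun y => flipAt y k) fun y => flipAt_flipAt y k) _))
    exact Finset.sum_le_sum fun y _ => mul_le_mul_of_nonneg_right
      (dampedSum_flip_le hP hb k x y) (pow_mulVec_nonneg (offSum_nonneg hP k) hφ N _)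

/-- Of the words of length `N` only those with at most one letter `k` are kept. For each of the `N`
positions of a single `k`, the flip there costs `κ`, the letters after it are damped by
`dampedSum_pow_le`, and those before it may be damped as well. -/
theorem sum_pow_ge (hP : IsSingleSite P) (hb : IsBounded A P γ) (hγ : 0 ≤ γ) (hκ : 0 ≤ κ)
    {k : Fin n} (hflip : ∀ x, κ ≤ flipProb P k x) {φ : Config n → ℝ} (hφ : ∀ x, 0 ≤ φ x) (N : ℕ)
    (x : Config n) :
    ((offSum P k ^ N) *ᵥ φ) x +
      κ * (N * ((dampedSum A P γ k ^ (N - 1)) *ᵥ fun y => φ (flipAt y k)) x) ≤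
      (((∑ i, P i) ^ N) *ᵥ φ) x := by
  induction N generalizing x with
  | zero => simp
  | succ N ih =>
    have hψ : ∀ y : Config n, 0 ≤ φ (flipAt y k) := fun y => hφ _
    have hR : ∑ i, P i = P k + offSum P k :=
      (Finset.add_sum_erase _ _ (Finset.mem_univ k)).symm
    have h1 : κ * ((dampedSum A P γ k ^ N) *ᵥ fun y => φ (flipAt y k)) x ≤
        (P k *ᵥ ((offSum P k ^ N) *ᵥ φ)) x := by
      have h0 := pow_mulVec_nonneg (offSum_nonneg hP k) hφ N
      calc _ ≤ flipProb P k x * ((offSum P k ^ N) *ᵥ φ) (flipAt x k) :=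
            mul_le_mul (hflip x) (dampedSum_pow_le hP hb k hφ N x)
              (pow_mulVec_nonneg (dampedSum_nonneg hP k) hψ N x) (hP.flipProb_nonneg k x)
        _ ≤ _ := by
            rw [hP.mulVec_eq]
            -- The contribution of an update at `k` that leaves the spin unchanged is nonnegative
            -- and is dropped.
            nlinarith [h0 x, hP.flipProb_le_one k x]
    have h2 : κ * (N * ((dampedSum A P γ k ^ N) *ᵥ fun y => φ (flipAt y k)) x) ≤
        κ * (N * (offSum P k *ᵥ ((dampedSum A P γ k ^ (N - 1)) *ᵥ
          fun y => φ (flipAt y k))) x) := by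
      rcases Nat.eq_zero_or_pos N with rfl | hN
      · simp
      · obtain ⟨M, rfl⟩ := Nat.exists_eq_add_of_le' hN
        rw [Nat.add_sub_cancel, pow_succ', ← Matrix.mulVec_mulVec]
        refine mul_le_mul_of_nonneg_left (mul_le_mul_of_nonneg_left ?_ (Nat.cast_nonneg _)) hκ
        exact Finset.sum_le_sum fun y _ => mul_le_mul_of_nonneg_right
          (dampedSum_le_offSum hP hγ k x y) (pow_mulVec_nonneg (dampedSum_nonneg hP k) hψ M y)
    have h3 := mulVec_mono (offSum_nonneg hP k) ih x
    have h4 : (offSum P k *ᵥ fun y => ((offSum P k ^ N) *ᵥ φ) y +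
        κ * (N * ((dampedSum A P γ k ^ (N - 1)) *ᵥ fun y => φ (flipAt y k)) y)) x =
        (offSum P k *ᵥ ((offSum P k ^ N) *ᵥ φ)) x + κ * (N * (offSum P k *ᵥ
          ((dampedSum A P γ k ^ (N - 1)) *ᵥ fun y => φ (flipAt y k))) x) := by
      simp only [Matrix.mulVec, dotProduct, mul_add, Finset.sum_add_distrib, Finset.mul_sum]
      congr 1
      refine Finset.sum_congr rfl fun y _ => Finset.sum_congr rfl fun z _ => by ring
    have h5 := mulVec_mono (hP.nonneg k) (φ := (offSum P k ^ N) *ᵥ φ)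
      (ψ := ((∑ i, P i) ^ N) *ᵥ φ) (fun y => le_trans (le_add_of_nonneg_right
        (mul_nonneg hκ (mul_nonneg (Nat.cast_nonneg _)
          (pow_mulVec_nonneg (dampedSum_nonneg hP k) hψ (N - 1) y)))) (ih y)) x
    rw [h4] at h3
    rw [pow_succ' (∑ i, P i), ← Matrix.mulVec_mulVec]
    conv_rhs => rw [hR, Matrix.add_mulVec, Pi.add_apply]
    rw [← hR, pow_succ', ← Matrix.mulVec_mulVec, Nat.add_sub_cancel]
    push_cast
    linarith

/-- A word with total exponent `s` is damped by `exp(-s) ≥ exp(-M) (1 + M - s)`, the tangent line at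
`M`. Since `ψ ≤ 1`, the term linear in `s` is at most the sum of `s` over all words, that is `N
c^(N-1)` times the sum of the exponents of the letters, with `c` the number of letters. -/
theorem dampedSum_pow_ge (hP : IsSingleSite P) (k : Fin n) {ψ : Config n → ℝ}
    (hψ0 : ∀ x, 0 ≤ ψ x) (hψ1 : ∀ x, ψ x ≤ 1) (hγ : 0 ≤ γ) (N : ℕ) (M : ℝ) (x : Config n) :
    Real.exp (-M) * ((1 + M) * ((offSum P k ^ N) *ᵥ ψ) x -
      (∑ m ∈ Finset.univ.erase k, γ * |A m k|) *
        (N * ((Finset.univ.erase k).card : ℝ) ^ (N - 1))) ≤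
      ((dampedSum A P γ k ^ N) *ᵥ ψ) x := by
  induction N generalizing M x with
  | zero =>
    have h1 : Real.exp (-M) * (1 + M) ≤ 1 := by
      rw [Real.exp_neg, inv_mul_le_iff₀ (Real.exp_pos _)]
      linarith [Real.add_one_le_exp M]
    have h2 := mul_le_of_le_one_left (hψ0 x) h1
    simpa [mul_assoc] using h2
  | succ N ih =>
    set c : ℝ := ((Finset.univ.erase k).card : ℝ)
    set a : Fin n → ℝ := fun m => γ * |A m k| with ha
    set v := (offSum P k ^ N) *ᵥ ψ with hv
    have hvle (m : Fin n) : (P m *ᵥ v) x ≤ c ^ N := by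
      have hvN (y : Config n) : v y ≤ c ^ N := by
        have h2 := pow_mulVec_nonneg (offSum_nonneg hP k) (φ := (fun _ => (1 : ℝ)) - ψ)
          (fun y => sub_nonneg.2 (hψ1 y)) N y
        rw [Matrix.mulVec_sub, Pi.sub_apply, pow_mulVec_const (offSum_row_sum hP k)] at h2
        linarith
      refine (mulVec_mono (hP.nonneg m) hvN x).trans (le_of_eq ?_)
      simp [Matrix.mulVec, dotProduct, ← Finset.sum_mul, hP.sum_eq_one]
    -- After the first letter `m` the tangent point becomes `M - a m`; the factor `exp(-(a m))`
    -- restores `exp(-M)`. This is why the induction runs over all real `M`.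
    have hstep (m : Fin n) :
        Real.exp (-M) * ((1 + (M - a m)) * (P m *ᵥ v) x -
          (∑ m ∈ Finset.univ.erase k, a m) * (N * c ^ (N - 1))) ≤
        Real.exp (-(a m)) * (P m *ᵥ ((dampedSum A P γ k ^ N) *ᵥ ψ)) x := by
      have h1 := mulVec_mono (hP.nonneg m) (ih (M - a m)) x
      have h2 : (P m *ᵥ fun y => Real.exp (-(M - a m)) * ((1 + (M - a m)) * v y -
          (∑ m ∈ Finset.univ.erase k, a m) * (N * c ^ (N - 1)))) x =
          Real.exp (-(M - a m)) * ((1 + (M - a m)) * (P m *ᵥ v) x -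
          (∑ m ∈ Finset.univ.erase k, a m) * (N * c ^ (N - 1))) := by
        rw [hP.mulVec_eq, hP.mulVec_eq]
        ring
      rw [h2] at h1
      have h3 := mul_le_mul_of_nonneg_left h1 (Real.exp_nonneg (-(a m)))
      rwa [← mul_assoc, ← Real.exp_add,
        show -(a m) + -(M - a m) = -M by ring] at h3
    have hoff : ((offSum P k ^ (N + 1)) *ᵥ ψ) x =
        ∑ m ∈ Finset.univ.erase k, (P m *ᵥ v) x := by
      rw [pow_succ', ← Matrix.mulVec_mulVec, ← hv, offSum, Matrix.sum_mulVec, Finset.sum_apply]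
    have hdam : ((dampedSum A P γ k ^ (N + 1)) *ᵥ ψ) x = ∑ m ∈ Finset.univ.erase k,
        Real.exp (-(a m)) * (P m *ᵥ ((dampedSum A P γ k ^ N) *ᵥ ψ)) x := by
      rw [pow_succ', ← Matrix.mulVec_mulVec]
      conv_lhs => rw [dampedSum, Matrix.sum_mulVec, Finset.sum_apply]
      exact Finset.sum_congr rfl fun m _ => by
        rw [Matrix.smul_mulVec]
        rfl
    have hNc : (N : ℝ) * c ^ (N - 1) * c = N * c ^ N := by
      rcases Nat.eq_zero_or_pos N with rfl | hN
      · simp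
      · rw [mul_assoc, pow_sub_one_mul hN.ne']
    have hasum : ∑ m ∈ Finset.univ.erase k, a m * (P m *ᵥ v) x ≤
        (∑ m ∈ Finset.univ.erase k, a m) * c ^ N := by
      rw [Finset.sum_mul]
      exact Finset.sum_le_sum fun m _ =>
        mul_le_mul_of_nonneg_left (hvle m) (mul_nonneg hγ (abs_nonneg _))
    rw [hdam, hoff, Nat.add_sub_cancel]
    refine le_trans ?_ (Finset.sum_le_sum fun m _ => hstep m)
    rw [← Finset.mul_sum _ _ (Real.exp (-M))]
    refine mul_le_mul_of_nonneg_left ?_ (Real.exp_nonneg _)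
    have hexp : ∑ m ∈ Finset.univ.erase k, ((1 + (M - a m)) * (P m *ᵥ v) x -
        (∑ m ∈ Finset.univ.erase k, a m) * (N * c ^ (N - 1))) =
        (1 + M) * (∑ m ∈ Finset.univ.erase k, (P m *ᵥ v) x) -
          ∑ m ∈ Finset.univ.erase k, a m * (P m *ᵥ v) x -
          (∑ m ∈ Finset.univ.erase k, a m) * (N * c ^ (N - 1) * c) := by
      rw [Finset.sum_sub_distrib, Finset.sum_const, nsmul_eq_mul, Finset.mul_sum,
        ← Finset.sum_sub_distrib]
      congr 1
      · exact Finset.sum_congr rfl fun m _ => by ring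
      · ring
    rw [hexp, hNc]
    push_cast
    linarith

theorem HasSum.shift_factorial {u : ℕ → ℝ} {s : ℝ}
    (hu : HasSum (fun N : ℕ => ((N.factorial : ℝ))⁻¹ * u N) s) :
    HasSum (fun N : ℕ => ((N.factorial : ℝ))⁻¹ * (N * u (N - 1))) s := by
  have h1 : (fun N : ℕ => (((N + 1).factorial : ℝ))⁻¹ * (((N + 1 : ℕ) : ℝ) * u (N + 1 - 1))) =
      fun N : ℕ => ((N.factorial : ℝ))⁻¹ * u N := by
    funext N
    have h2 : ((N : ℝ) + 1) ≠ 0 := by positivity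
    have h3 : (N.factorial : ℝ) ≠ 0 := by positivity
    rw [Nat.add_sub_cancel, Nat.factorial_succ]
    push_cast
    field_simp
  have := (hasSum_nat_add_iff (f := fun N : ℕ => ((N.factorial : ℝ))⁻¹ * (N * u (N - 1))) 1).1
    (by rw [h1]; exact hu)
  simpa using this

/-- If `φ` is at least `1/2` on average over the two values of the spin at `k`, then so it is in
mean after unit time, up to the influence of `k` on the other sites. -/
theorem evol_one_ge (hA : IsingAssumption A h d lam α) (hP : IsSingleSite P)
    (hb : IsBounded A P γ) (hγ : 0 ≤ γ) (hκ : 0 ≤ κ) {k : Fin n}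
    (hflip : ∀ x, κ ≤ flipProb P k x) {φ : Config n → ℝ} (hφ0 : ∀ x, 0 ≤ φ x)
    (hφ1 : ∀ x, φ x ≤ 1) (hφ : ∀ x, 1 ≤ φ x + φ (flipAt x k)) (x : Config n) :
    Real.exp (-1) / 2 * κ * Real.exp (-(2 * γ * lam)) ≤ evol P 1 φ x := by
  set c : ℝ := ((Finset.univ.erase k).card : ℝ) with hc
  set a : ℝ := ∑ m ∈ Finset.univ.erase k, γ * |A m k| with ha
  -- The missing letter leaves `exp(-n) exp(c) = exp(-1)` after normalization.
  have hcn : c = n - 1 := by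
    rw [hc, Finset.card_erase_of_mem (Finset.mem_univ k), Finset.card_univ, Fintype.card_fin,
      Nat.cast_sub (Fin.pos k)]
    simp
  have ha0 : 0 ≤ a := Finset.sum_nonneg fun m _ => mul_nonneg hγ (abs_nonneg _)
  have hal : a ≤ γ * lam := by
    rw [ha, ← Finset.mul_sum]
    refine mul_le_mul_of_nonneg_left (le_trans ?_ (hA.width k)) hγ
    refine le_add_of_le_of_nonneg (le_of_eq ?_) (abs_nonneg _)
    exact Finset.sum_congr rfl fun m _ => by rw [hA.symm.apply k m]
  set ψ : Config n → ℝ := fun y => φ (flipAt y k) with hψ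
  set V := (NormedSpace.exp (offSum P k) *ᵥ φ) x with hV
  set W := (NormedSpace.exp (offSum P k) *ᵥ ψ) x with hW
  set U := (NormedSpace.exp (dampedSum A P γ k) *ᵥ ψ) x with hU
  have hV0 : 0 ≤ V := exp_mulVec_nonneg (offSum_nonneg hP k) hφ0 x
  have hU0 : 0 ≤ U := exp_mulVec_nonneg (dampedSum_nonneg hP k) (fun y => hφ0 _) x
  have hVW : Real.exp c ≤ V + W := by
    have h1 := exp_mulVec_nonneg (offSum_nonneg hP k)
      (φ := (φ + ψ) - fun _ => 1) (fun y => sub_nonneg.2 (hφ y)) x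
    rw [Matrix.mulVec_sub, Matrix.mulVec_add, Pi.sub_apply, Pi.add_apply,
      exp_mulVec_const (offSum_row_sum hP k)] at h1
    linarith
  have hsum : V + κ * U ≤ (NormedSpace.exp (∑ i, P i) *ᵥ φ) x := by
    refine hasSum_le (fun N => ?_) ((hasSum_exp_mulVec (offSum P k) φ x).add
      ((HasSum.shift_factorial (hasSum_exp_mulVec (dampedSum A P γ k) ψ x)).mul_left κ))
      (hasSum_exp_mulVec (∑ i, P i) φ x)
    have := mul_le_mul_of_nonneg_left (sum_pow_ge hP hb hγ hκ hflip hφ0 N x)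
      (inv_nonneg.2 (Nat.cast_nonneg (α := ℝ) N.factorial))
    refine le_trans (le_of_eq ?_) this
    ring
  -- The tangent point `M = 2a` fits the case `W ≥ exp(c) / 2`: then `(1 + 2a) W - a exp(c) ≥ exp(c)
  -- / 2`, the linear loss being exactly absorbed.
  have hUge : Real.exp (-(2 * a)) * ((1 + 2 * a) * W - a * Real.exp c) ≤ U := by
    refine hasSum_le (fun N => ?_) ((((hasSum_exp_mulVec (offSum P k) ψ x).mul_left
      (1 + 2 * a)).sub ((HasSum.shift_factorial (hasSum_real_exp c)).mul_left a)).mul_left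
        (Real.exp (-(2 * a)))) (hasSum_exp_mulVec (dampedSum A P γ k) ψ x)
    have := mul_le_mul_of_nonneg_left (dampedSum_pow_ge (A := A) hP k (ψ := ψ) (fun y => hφ0 _)
      (fun y => hφ1 _) hγ N (2 * a) x) (inv_nonneg.2 (Nat.cast_nonneg (α := ℝ) N.factorial))
    refine le_trans (le_of_eq ?_) this
    ring
  have hκ1 : κ ≤ 1 := (hflip x).trans (hP.flipProb_le_one k x)
  have hmain : Real.exp c / 2 * (κ * Real.exp (-(2 * a))) ≤ V + κ * U := by
    have he := Real.exp_pos c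
    -- Since `V + W ≥ exp(c)`, either `W`, which needs a flip at `k`, or `V`, which needs no update
    -- at `k`, is at least half of the total.
    rcases le_total (Real.exp c / 2) W with hle | hle
    · have h1 : Real.exp c / 2 ≤ (1 + 2 * a) * W - a * Real.exp c := by nlinarith
      have h2 := (mul_le_mul_of_nonneg_left h1 (Real.exp_nonneg (-(2 * a)))).trans hUge
      have h3 := mul_le_mul_of_nonneg_left h2 hκ
      linarith
    · have h1 : κ * Real.exp (-(2 * a)) ≤ 1 :=
        mul_le_one₀ hκ1 (Real.exp_nonneg _) (Real.exp_le_one_iff.2 (by linarith))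
      have h2 := mul_nonneg hκ hU0
      nlinarith
  rw [evol_eq, one_mul, one_smul]
  have h1 : Real.exp (-(n : ℝ)) * Real.exp c = Real.exp (-1) := by
    rw [← Real.exp_add, hcn]
    ring_nf
  have h2 : Real.exp (-(2 * γ * lam)) ≤ Real.exp (-(2 * a)) := Real.exp_le_exp.2 (by linarith)
  calc Real.exp (-1) / 2 * κ * Real.exp (-(2 * γ * lam))
      ≤ Real.exp (-1) / 2 * κ * Real.exp (-(2 * a)) := by gcongr
    _ = Real.exp (-(n : ℝ)) * (Real.exp c / 2 * (κ * Real.exp (-(2 * a)))) := by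
      rw [← h1]
      ring
    _ ≤ _ := mul_le_mul_of_nonneg_left (hmain.trans hsum) (Real.exp_nonneg _)

end FlipCycle

namespace FlipCycle

variable {n : ℕ} {Ω : Type*} [MeasurableSpace Ω] {μ : Measure Ω}
  {P : Fin n → Matrix (Config n) (Config n) ℝ} {X : ℝ≥0 → Ω → Config n}

/-! ### Conditional bounds on probabilities -/

/-- Given the history up to time `s`, the conditional probability of `V` is at most `q`. -/
def CondProbLe (μ : Measure Ω) (X : ℝ≥0 → Ω → Config n) (s : ℝ≥0) (V : Set Ω) (q : ℝ) : Prop :=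
  ∀ A, MeasurableSet[history X s] A → μ.real (A ∩ V) ≤ q * μ.real A

theorem CondProbLe.anti {s t : ℝ≥0} (hst : s ≤ t) {V : Set Ω} {q : ℝ}
    (h : CondProbLe μ X t V q) : CondProbLe μ X s V q :=
  fun A hA => h A (history_mono X hst _ hA)

theorem CondProbLe.union {s : ℝ≥0} {V V' : Set Ω} {q q' : ℝ} (h : CondProbLe μ X s V q)
    (h' : CondProbLe μ X s V' q') : CondProbLe μ X s (V ∪ V') (q + q') := fun A hA => by
  rw [Set.inter_union_distrib_left, add_mul]
  exact (measureReal_union_le _ _).trans (add_le_add (h A hA) (h' A hA))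

theorem CondProbLe.biUnion {ι : Type*} {s : ℝ≥0} (T : Finset ι) {V : ι → Set Ω} {q : ℝ}
    (h : ∀ r ∈ T, CondProbLe μ X s (V r) q) :
    CondProbLe μ X s (⋃ r ∈ T, V r) (T.card * q) := fun A hA => by
  rw [Set.inter_iUnion₂]
  refine (measureReal_biUnion_finset_le T _).trans
    ((Finset.sum_le_card_nsmul T _ _ fun r hr => h r hr A hA).trans (le_of_eq ?_))
  rw [nsmul_eq_mul, mul_assoc]

/-- Conditional bounds multiply along time: `A ∩ V` belongs to the history at `u`, so it is an
admissible conditioning event for the later bound. -/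
theorem CondProbLe.inter {s u : ℝ≥0} (hsu : s ≤ u) {V V' : Set Ω} {q q' : ℝ} (hq' : 0 ≤ q')
    (hV : MeasurableSet[history X u] V) (h : CondProbLe μ X s V q)
    (h' : CondProbLe μ X u V' q') : CondProbLe μ X s (V ∩ V') (q * q') := fun A hA => by
  rw [← Set.inter_assoc]
  refine (h' _ ((history_mono X hsu _ hA).inter hV)).trans ?_
  calc q' * μ.real (A ∩ V) ≤ q' * (q * μ.real A) := mul_le_mul_of_nonneg_left (h A hA) hq'
    _ = _ := by ring

theorem CondProbLe.iInter {τ : ℕ → ℝ≥0} (hτ : Monotone τ) {V : ℕ → Set Ω} {q : ℕ → ℝ}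
    (hq : ∀ r, 0 ≤ q r) (hV : ∀ r, MeasurableSet[history X (τ (r + 1))] (V r))
    (h : ∀ r, CondProbLe μ X (τ r) (V r) (q r)) (m : ℕ) :
    MeasurableSet[history X (τ m)] (⋂ r ∈ Finset.range m, V r) ∧
      CondProbLe μ X (τ 0) (⋂ r ∈ Finset.range m, V r) (∏ r ∈ Finset.range m, q r) := by
  induction m with
  | zero =>
    simp only [Finset.range_zero, Finset.notMem_empty, Set.iInter_of_empty, Set.iInter_univ,
      Finset.prod_empty]
    exact ⟨MeasurableSet.univ, fun A _ => by rw [Set.inter_univ, one_mul]⟩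
  | succ m ih =>
    have hset : ⋂ r ∈ Finset.range (m + 1), V r = (⋂ r ∈ Finset.range m, V r) ∩ V m := by
      rw [Finset.range_add_one, Finset.set_biInter_insert, Set.inter_comm]
    rw [hset, Finset.prod_range_succ]
    exact ⟨(history_mono X (hτ (Nat.le_succ m)) _ ih.1).inter (hV m),
      ih.2.inter (hτ (Nat.zero_le m)) (hq m) ih.1 (h m)⟩

/-! ### The Markov property -/

variable [IsProbabilityMeasure μ]

theorem IsSingleSiteChain.integrable_comp (hX : IsSingleSiteChain μ P X) (φ : Config n → ℝ)
    (t : ℝ≥0) : Integrable (fun ω => φ (X t ω)) μ :=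
  (Integrable.of_finite (μ := μ.map (X t)) (f := φ)).comp_measurable (hX.measurable t)

theorem IsSingleSiteChain.condExp_comp (hX : IsSingleSiteChain μ P X) (φ : Config n → ℝ)
    {s t : ℝ≥0} (hst : s ≤ t) :
    μ[fun ω => φ (X t ω) | history X s] =ᵐ[μ] fun ω => evol P ((t : ℝ) - s) φ (X s ω) := by
  have h1 : (fun ω => φ (X t ω)) =
      ∑ y, φ y • ({ω | X t ω = y}.indicator fun _ => (1 : ℝ)) := by
    funext ω
    rw [Finset.sum_apply, Finset.sum_eq_single (X t ω)]
    · simp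
    · intro y _ hy
      simp [hy.symm]
    · simp
  have hms (y : Config n) : MeasurableSet {ω | X t ω = y} :=
    hX.measurable t (measurableSet_singleton y)
  rw [h1]
  refine (condExp_finsetSum (fun y _ => ((integrable_const (1 : ℝ)).indicator
    (hms y)).smul (φ y)) _).trans ?_
  have h2 : ∀ᵐ ω ∂μ, ∀ y,
      (μ[φ y • ({ω | X t ω = y}.indicator fun _ => (1 : ℝ)) | history X s]) ω =
        φ y * semigroup P ((t : ℝ) - s) (X s ω) y := by
    refine ae_all_iff.2 fun y => ?_
    filter_upwards [condExp_smul (φ y) ({ω | X t ω = y}.indicator fun _ => (1 : ℝ)) (history X s)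
      (μ := μ), hX.markov s t hst y] with ω h3 h4
    rw [h3, Pi.smul_apply, h4, smul_eq_mul]
  filter_upwards [h2] with ω hω
  rw [Finset.sum_apply, evol, Matrix.mulVec, dotProduct]
  exact Finset.sum_congr rfl fun y _ => by rw [hω y, mul_comm]

/-- The Markov property for functions of two times, obtained by splitting according to the value of
`X s` and freezing the first argument. -/
theorem IsSingleSiteChain.setIntegral_comp (hX : IsSingleSiteChain μ P X)
    (φ : Config n → Config n → ℝ) {s t : ℝ≥0} (hst : s ≤ t) {A : Set Ω}
    (hA : MeasurableSet[history X s] A) :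
    ∫ ω in A, φ (X s ω) (X t ω) ∂μ =
      ∫ ω in A, evol P ((t : ℝ) - s) (φ (X s ω)) (X s ω) ∂μ := by
  have hS (x : Config n) : MeasurableSet[history X s] {ω | X s ω = x} :=
    measurable_history X le_rfl (measurableSet_singleton x)
  have hS' (x : Config n) : MeasurableSet {ω | X s ω = x} := hX.history_le s _ (hS x)
  have split (F : Config n → Ω → ℝ) (hF : ∀ x, Integrable (F x) μ) :
      ∫ ω in A, F (X s ω) ω ∂μ = ∑ x, ∫ ω in A ∩ {ω | X s ω = x}, F x ω ∂μ := by
    have h1 : (fun ω => F (X s ω) ω) = fun ω => ∑ x, {ω | X s ω = x}.indicator (F x) ω := by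
      funext ω
      rw [Finset.sum_eq_single (X s ω)]
      · simp
      · intro y _ hy
        simp [hy.symm]
      · simp
    rw [h1, integral_finsetSum _ fun x _ => ((hF x).indicator (hS' x)).integrableOn]
    exact Finset.sum_congr rfl fun x _ => setIntegral_indicator (hS' x)
  rw [split (fun x ω => φ x (X t ω)) fun x => hX.integrable_comp (φ x) t,
    split (fun x ω => evol P ((t : ℝ) - s) (φ x) (X s ω)) fun x =>
      hX.integrable_comp (evol P ((t : ℝ) - s) (φ x)) s]
  refine Finset.sum_congr rfl fun x _ => ?_
  rw [← setIntegral_condExp (hX.history_le s) (hX.integrable_comp (φ x) t) (hA.inter (hS x))]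
  exact integral_congr_ae (ae_restrict_of_ae (hX.condExp_comp (φ x) hst))

theorem CondProbLe.mono {s : ℝ≥0} {V V' : Set Ω} (hVV : V ⊆ V') {q q' : ℝ} (hq : q ≤ q')
    (h : CondProbLe μ X s V' q) : CondProbLe μ X s V q' := fun A hA =>
  (measureReal_mono (Set.inter_subset_inter_right A hVV)).trans
    ((h A hA).trans (mul_le_mul_of_nonneg_right hq measureReal_nonneg))

/-- Fatou's lemma for sets: `B` lies in the increasing union of the tail intersections of `C`. -/
theorem measureReal_le_of_eventually {B : Set Ω} {C : ℕ → Set Ω} (hC : ∀ ω ∈ B, ∀ᶠ N in atTop,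
    ω ∈ C N) {c : ℝ} (hc : ∀ᶠ N in atTop, μ.real (C N) ≤ c) : μ.real B ≤ c := by
  have hc0 : 0 ≤ c := by
    obtain ⟨N, hN⟩ := hc.exists
    exact measureReal_nonneg.trans hN
  have hsub : B ⊆ ⋃ K : ℕ, ⋂ N : ℕ, ⋂ _ : K ≤ N, C N := by
    intro ω hω
    obtain ⟨K, hK⟩ := eventually_atTop.1 (hC ω hω)
    exact Set.mem_iUnion.2 ⟨K, Set.mem_iInter₂.2 hK⟩
  have hmono : Monotone fun K : ℕ => ⋂ N : ℕ, ⋂ _ : K ≤ N, C N := fun K L hKL =>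
    Set.iInter_mono fun N => Set.iInter_mono' fun h => ⟨hKL.trans h, le_rfl⟩
  refine ENNReal.toReal_le_of_le_ofReal hc0 ((measure_mono hsub).trans ?_)
  rw [hmono.measure_iUnion]
  refine iSup_le fun K => ?_
  obtain ⟨N, hN, hKN⟩ := (hc.and (eventually_ge_atTop K)).exists
  refine (measure_mono (Set.iInter₂_subset N hKN)).trans ?_
  rw [← ENNReal.ofReal_toReal (measure_ne_top μ (C N))]
  exact ENNReal.ofReal_le_ofReal hN

theorem CondProbLe.of_eventually {s : ℝ≥0} {V : Set Ω} {C : ℕ → Set Ω}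
    (hC : ∀ ω ∈ V, ∀ᶠ N in atTop, ω ∈ C N) {q : ℝ} (h : ∀ N, CondProbLe μ X s (C N) q) :
    CondProbLe μ X s V q := fun A hA =>
  measureReal_le_of_eventually (C := fun N => A ∩ C N)
    (fun ω hω => (hC ω hω.2).mono fun _ hN => ⟨hω.1, hN⟩) (Eventually.of_forall fun N => h N A hA)

theorem IsSingleSiteChain.condExp_le (hX : IsSingleSiteChain μ P X) {s : ℝ≥0} {V : Set Ω}
    {q : ℝ} (h : CondProbLe μ X s V q) (hV : MeasurableSet V) :
    ∀ᵐ ω ∂μ, (μ[V.indicator fun _ => (1 : ℝ) | obs X s]) ω ≤ q := by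
  have hm := hX.hasCadlagPaths.obs_le_history s
  have hm0 := hX.obs_le s
  have hint : Integrable (V.indicator fun _ => (1 : ℝ)) μ := (integrable_const 1).indicator hV
  change (μ[V.indicator fun _ => (1 : ℝ) | obs X s]) ≤ᵐ[μ] fun _ => q
  refine ae_le_of_ae_le_trim (E := ℝ) (hm := hm0) ?_
  refine ae_le_of_forall_setIntegral_le (integrable_condExp.trim hm0 stronglyMeasurable_condExp)
    (integrable_const q) fun A hA _ => ?_
  rw [← setIntegral_trim hm0 stronglyMeasurable_condExp hA, setIntegral_condExp hm0 hint hA,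
    setIntegral_indicator hV, setIntegral_const, setIntegral_const, smul_eq_mul, smul_eq_mul,
    mul_one, mul_comm, measureReal_def (μ.trim hm0), trim_measurableSet_eq hm0 hA]
  exact h A (hm _ hA)

open Classical in
theorem IsSingleSiteChain.condProbLe_two (hX : IsSingleSiteChain μ P X)
    (p : Config n → Config n → Prop) {s t : ℝ≥0} (hst : s ≤ t) {q : ℝ}
    (h : ∀ x, evol P ((t : ℝ) - s) (fun y => if p x y then 1 else 0) x ≤ q) :
    CondProbLe μ X s {ω | p (X s ω) (X t ω)} q := by
  intro A hA
  have hA' := hX.history_le s _ hA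
  have hp : MeasurableSet {ω | p (X s ω) (X t ω)} :=
    hX.history_le t _ (measurableSet_history_two X hst le_rfl p)
  have h1 := hX.setIntegral_comp (fun x y => if p x y then (1 : ℝ) else 0) hst hA
  have h2 : (fun ω => if p (X s ω) (X t ω) then (1 : ℝ) else 0) =
      {ω | p (X s ω) (X t ω)}.indicator fun _ => 1 := by
    funext ω
    simp [Set.indicator_apply]
  rw [h2, setIntegral_indicator hp, setIntegral_const, smul_eq_mul, mul_one] at h1
  rw [h1]
  have h3 := setIntegral_mono (s := A) (hX.integrable_comp
    (fun x => evol P ((t : ℝ) - s) (fun y => if p x y then (1 : ℝ) else 0) x) s).integrableOn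
    (integrable_const q) fun ω => h (X s ω)
  refine h3.trans (le_of_eq ?_)
  rw [setIntegral_const, smul_eq_mul, mul_comm]

theorem IsSingleSiteChain.condProbLe_ne (hX : IsSingleSiteChain μ P X) (hP : IsSingleSite P)
    (i : Fin n) {s t : ℝ≥0} (hst : s ≤ t) :
    CondProbLe μ X s {ω | X t ω i ≠ X s ω i} ((t : ℝ) - s) :=
  hX.condProbLe_two (fun x y => y i ≠ x i) hst fun x => by
    convert hP.evol_ne_le x i (sub_nonneg.2 (NNReal.coe_le_coe.2 hst))

theorem IsSingleSiteChain.condProbLe_ne_ne (hX : IsSingleSiteChain μ P X) (hP : IsSingleSite P)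
    {i j : Fin n} (hij : i ≠ j) {s t : ℝ≥0} (hst : s ≤ t) :
    CondProbLe μ X s {ω | X t ω i ≠ X s ω i ∧ X t ω j ≠ X s ω j} (((t : ℝ) - s) ^ 2) :=
  hX.condProbLe_two (fun x y => y i ≠ x i ∧ y j ≠ x j) hst fun x => by
    convert hP.evol_ne_ne_le x hij (sub_nonneg.2 (NNReal.coe_le_coe.2 hst))

theorem IsSingleSiteChain.condProbLe_pairChange (hX : IsSingleSiteChain μ P X)
    (hP : IsSingleSite P) (i j : Fin n) {s t : ℝ≥0} (hst : s ≤ t) :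
    CondProbLe μ X s (pairChange X i j s t) (2 * ((t : ℝ) - s)) := by
  rw [two_mul]
  exact (hX.condProbLe_ne hP i hst).union (hX.condProbLe_ne hP j hst)

end FlipCycle

namespace FlipCycle

/-! ### Flips in a window -/

variable {n : ℕ} {Ω : Type*}

/-- At least two flips of the sites `i` and `j` in the interval `(a, b]`. -/
def twoFlips (X : ℝ≥0 → Ω → Config n) (i j : Fin n) (a b : ℝ≥0) : Set Ω :=
  {ω | 2 ≤ (jumps (fun u => X u ω i) ∩ Set.Ioc a b).encard +
    (jumps (fun u => X u ω j) ∩ Set.Ioc a b).encard}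

theorem HasCadlagPaths.measurableSet_twoFlips {X : ℝ≥0 → Ω → Config n} (hX : HasCadlagPaths X) (i j : Fin n) {a b : ℝ≥0}
    (hab : a ≤ b) : MeasurableSet[history X b] (twoFlips X i j a b) := by
  let _ := history X b
  exact (measurable_of_countable fun q : ℕ∞ × ℕ∞ => q.1 + q.2).comp
    ((hX.measurable_Ioc i hab).prodMk (hX.measurable_Ioc j hab)) (MeasurableSet.of_discrete
      (s := Set.Ici 2))

theorem exists_of_two_le_changes {α β : Type*} (y : ℝ≥0 → α) (z : ℝ≥0 → β) (a b : ℝ≥0) (N : ℕ)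
    (h : 2 ≤ changes y a b N + changes z a b N) :
    (∃ r ∈ Finset.range (N + 1), y (gridPt a b N (r + 1)) ≠ y (gridPt a b N r) ∧
      z (gridPt a b N (r + 1)) ≠ z (gridPt a b N r)) ∨
    ∃ r ∈ Finset.range (N + 1), ∃ r' ∈ Finset.range (N + 1), r < r' ∧
      (y (gridPt a b N (r + 1)) ≠ y (gridPt a b N r) ∨
        z (gridPt a b N (r + 1)) ≠ z (gridPt a b N r)) ∧
      (y (gridPt a b N (r' + 1)) ≠ y (gridPt a b N r') ∨
        z (gridPt a b N (r' + 1)) ≠ z (gridPt a b N r')) := by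
  classical
  by_contra! hcon
  obtain ⟨h1, h2⟩ := hcon
  rw [changes, changes, ← Finset.sum_add_distrib] at h
  have hone : ∀ r ∈ Finset.range (N + 1),
      ((if y (gridPt a b N r) ≠ y (gridPt a b N (r + 1)) then 1 else 0) +
        if z (gridPt a b N r) ≠ z (gridPt a b N (r + 1)) then 1 else 0) ≤ 1 := by
    intro r hr
    by_cases hy : y (gridPt a b N (r + 1)) = y (gridPt a b N r)
    · rw [if_neg (not_not.2 hy.symm)]
      split_ifs <;> omega
    · rw [if_neg (not_not.2 (h1 r hr hy).symm)]
      split_ifs <;> omega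
  have hne : ∃ r ∈ Finset.range (N + 1),
      ((if y (gridPt a b N r) ≠ y (gridPt a b N (r + 1)) then 1 else 0) +
        if z (gridPt a b N r) ≠ z (gridPt a b N (r + 1)) then 1 else 0) ≠ 0 := by
    by_contra! hall
    rw [Finset.sum_eq_zero hall] at h
    omega
  have hchg (r : ℕ) (hr : ((if y (gridPt a b N r) ≠ y (gridPt a b N (r + 1)) then 1 else 0) +
        if z (gridPt a b N r) ≠ z (gridPt a b N (r + 1)) then 1 else 0) ≠ 0) :
      y (gridPt a b N (r + 1)) ≠ y (gridPt a b N r) ∨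
        z (gridPt a b N (r + 1)) ≠ z (gridPt a b N r) := by
    by_contra! hc
    rw [if_neg (not_not.2 hc.1.symm), if_neg (not_not.2 hc.2.symm)] at hr
    exact hr rfl
  have h2' (r : ℕ) (hr : r ∈ Finset.range (N + 1)) (r' : ℕ) (hr' : r' ∈ Finset.range (N + 1))
      (hlt : r < r') (hc : y (gridPt a b N (r + 1)) ≠ y (gridPt a b N r) ∨
        z (gridPt a b N (r + 1)) ≠ z (gridPt a b N r))
      (hc' : y (gridPt a b N (r' + 1)) ≠ y (gridPt a b N r') ∨
        z (gridPt a b N (r' + 1)) ≠ z (gridPt a b N r')) : False := by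
    have h3 := h2 r hr r' hr' hlt hc
    exact hc'.elim (fun h4 => h4 h3.1) fun h4 => h4 h3.2
  obtain ⟨r, hr, hr0⟩ := hne
  rw [Finset.sum_eq_single_of_mem r hr] at h
  · have := hone r hr
    omega
  · intro r' hr' hrr
    by_contra h0
    rcases lt_or_gt_of_ne hrr with hlt | hlt
    · exact h2' r' hr' r hr hlt (hchg r' h0) (hchg r hr0)
    · exact h2' r hr r' hr' hlt (hchg r hr0) (hchg r' h0)

/-- The event that the spins at the end points of the successive windows of length `ε` after
`t` change according to the sequence `l`. -/
def windowEvent (X : ℝ≥0 → Ω → Config n) (i j : Fin n) (ε t : ℝ≥0) {m : ℕ}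
    (l : Fin m → Fin n) : Set Ω :=
  {ω | ∀ r : Fin m, FlipsOnly i j (l r) (X (t + (r : ℕ) * ε) ω) (X (t + ((r : ℕ) + 1) * ε) ω)}

theorem windowEvent_succ (X : ℝ≥0 → Ω → Config n) (i j : Fin n) (ε t : ℝ≥0) {m : ℕ}
    (l : Fin (m + 1) → Fin n) : windowEvent X i j ε t l =
      {ω | FlipsOnly i j (l 0) (X t ω) (X (t + ε) ω)} ∩
        windowEvent X i j ε (t + ε) (Fin.tail l) := by
  ext ω
  simp only [windowEvent, Set.mem_ofPred_eq, Set.mem_inter_iff, Fin.forall_fin_succ, Fin.tail]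
  have h1 : t + ((0 : Fin (m + 1)) : ℕ) * ε = t := by simp
  have h2 : t + (((0 : Fin (m + 1)) : ℕ) + 1) * ε = t + ε := by simp
  rw [h1, h2]
  refine and_congr_right fun _ => forall_congr' fun r => ?_
  have h3 : t + ((r.succ : Fin (m + 1)) : ℕ) * ε = t + ε + (r : ℕ) * ε := by
    rw [Fin.val_succ]
    push_cast
    ring
  have h4 : t + (((r.succ : Fin (m + 1)) : ℕ) + 1) * ε = t + ε + ((r : ℕ) + 1) * ε := by
    rw [Fin.val_succ]
    push_cast
    ring
  rw [h3, h4]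

variable [MeasurableSpace Ω] {μ : Measure Ω}
  {P : Fin n → Matrix (Config n) (Config n) ℝ} {X : ℝ≥0 → Ω → Config n}

theorem IsSingleSiteChain.measurableSet_windowEvent (hX : IsSingleSiteChain μ P X) (i j : Fin n)
    (ε t : ℝ≥0) {m : ℕ} (l : Fin m → Fin n) : MeasurableSet (windowEvent X i j ε t l) := by
  have : windowEvent X i j ε t l = ⋂ r : Fin m, {ω | FlipsOnly i j (l r)
      (X (t + (r : ℕ) * ε) ω) (X (t + ((r : ℕ) + 1) * ε) ω)} := by
    ext ω
    simp [windowEvent]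
  rw [this]
  refine .iInter fun r => ?_
  exact hX.history_le (t + ((r : ℕ) + 1) * ε) _ (measurableSet_history_two X
    (by gcongr; exact le_self_add) le_rfl (FlipsOnly i j (l r)))

variable [IsProbabilityMeasure μ]

/-- A flip at `s` makes the spin at `s` differ from the spin at all close enough earlier times, an
event whose probability is at most the time difference. -/
theorem IsSingleSiteChain.ae_notMem_flipTimes (hX : IsSingleSiteChain μ P X)
    (hP : IsSingleSite P) (i : Fin n) (s : ℝ≥0) : ∀ᵐ ω ∂μ, s ∉ flipTimes X i ω := by
  rcases eq_or_lt_of_le (zero_le (a := s)) with rfl | hs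
  · exact Eventually.of_forall fun ω => zero_notMem_jumps _
  have hle (N : ℕ) : s / (N + 1) ≤ s := div_le_self (zero_le (a := s)) (by simp)
  have hlim : Tendsto (fun N : ℕ => (s : ℝ) / ((N : ℝ) + 1)) atTop (𝓝 0) :=
    tendsto_div_add_one_zero _
  have hsub : Tendsto (fun N : ℕ => s - s / (N + 1)) atTop (𝓝[<] s) := by
    refine tendsto_nhdsWithin_iff.2 ⟨?_, Eventually.of_forall fun N =>
      tsub_lt_self hs (by positivity)⟩
    rw [← NNReal.tendsto_coe]
    have h1 := tendsto_const_nhds.sub hlim (a := (s : ℝ))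
    rw [sub_zero] at h1
    refine h1.congr fun N => ?_
    rw [NNReal.coe_sub (hle N)]
    push_cast
    rfl
  have hzero : μ.real {ω | s ∈ flipTimes X i ω} ≤ 0 := by
    refine le_of_forall_pos_le_add fun q hq => ?_
    rw [zero_add]
    refine measureReal_le_of_eventually
      (C := fun N : ℕ => {ω | X s ω i ≠ X (s - s / (N + 1)) ω i}) (fun ω hω => ?_) ?_
    · have h1 := ((hX.hasCadlagPaths ω i).tendsto_leftLim s).comp hsub
      rw [nhds_discrete, tendsto_pure] at h1
      filter_upwards [h1] with N hN
      have hω' : Function.leftLim (fun u => X u ω i) s ≠ X s ω i := hω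
      rw [← hN] at hω'
      exact hω'.symm
    · filter_upwards [hlim.eventually (gt_mem_nhds hq)] with N hN
      have h1 := hX.condProbLe_ne hP i (tsub_le_self (a := s) (b := s / (N + 1))) _
        MeasurableSet.univ
      rw [Set.univ_inter, probReal_univ, mul_one, NNReal.coe_sub (hle N)] at h1
      push_cast at h1
      linarith
  have h0 : μ.real {ω | s ∈ flipTimes X i ω} = 0 := le_antisymm hzero measureReal_nonneg
  rw [measureReal_eq_zero_iff] at h0
  rw [ae_iff]
  simpa using h0

/-- On a fine grid, two flips show up either as changes of both spins over one cell or as changes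
over two different cells. With cells of length `L / (N + 1)` the union bounds are at most `L²` and
`4 L²`, uniformly in `N`. -/
theorem IsSingleSiteChain.condProbLe_twoFlips (hX : IsSingleSiteChain μ P X)
    (hP : IsSingleSite P) {i j : Fin n} (hij : i ≠ j) {a b : ℝ≥0} (hab : a ≤ b) :
    CondProbLe μ X a (twoFlips X i j a b) (5 * ((b : ℝ) - a) ^ 2) := by
  set t : ℕ → ℕ → ℝ≥0 := gridPt a b with ht
  set L : ℝ := (b : ℝ) - a with hL
  have hL0 : 0 ≤ L := sub_nonneg.2 (NNReal.coe_le_coe.2 hab)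
  have hstep (N r : ℕ) : ((t N (r + 1) : ℝ≥0) : ℝ) - t N r = L / (N + 1) := by
    rw [ht, gridPt_succ, NNReal.coe_add, NNReal.coe_div, NNReal.coe_sub hab]
    push_cast
    ring
  have hmono (N : ℕ) : Monotone (t N) := gridPt_mono a b N
  have hstart (N r : ℕ) : a ≤ t N r :=
    (gridPt_zero a b N).symm.trans_le (hmono N (Nat.zero_le r))
  refine CondProbLe.of_eventually (C := fun N =>
    (⋃ r ∈ Finset.range (N + 1), {ω | X (t N (r + 1)) ω i ≠ X (t N r) ω i ∧
      X (t N (r + 1)) ω j ≠ X (t N r) ω j}) ∪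
    ⋃ q ∈ ((Finset.range (N + 1)) ×ˢ (Finset.range (N + 1))).filter fun q => q.1 < q.2,
      pairChange X i j (t N q.1) (t N (q.1 + 1)) ∩
        pairChange X i j (t N q.2) (t N (q.2 + 1))) (fun ω hω => ?_) fun N => ?_
  · filter_upwards [(hX.hasCadlagPaths ω i).eventually_changes hab,
      (hX.hasCadlagPaths ω j).eventually_changes hab] with N h1 h2
    have h3 : (2 : ℕ∞) ≤ (changes (fun u => X u ω i) a b N : ℕ∞) +
        (changes (fun u => X u ω j) a b N : ℕ∞) := by
      rw [h1, h2]
      exact hω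
    rcases exists_of_two_le_changes _ _ a b N (by exact_mod_cast h3) with
      ⟨r, hr, h⟩ | ⟨r, hr, r', hr', hlt, h, h'⟩
    · exact Or.inl (Set.mem_iUnion₂.2 ⟨r, hr, h⟩)
    · exact Or.inr (Set.mem_iUnion₂.2 ⟨(r, r'), Finset.mem_filter.2
        ⟨Finset.mem_product.2 ⟨hr, hr'⟩, hlt⟩, h, h'⟩)
  · have hN : (0 : ℝ) < (N : ℝ) + 1 := by positivity
    have hb1 : ∀ r ∈ Finset.range (N + 1), CondProbLe μ X a
        {ω | X (t N (r + 1)) ω i ≠ X (t N r) ω i ∧ X (t N (r + 1)) ω j ≠ X (t N r) ω j}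
        ((L / (N + 1)) ^ 2) := fun r _ => by
      rw [← hstep N r]
      exact (hX.condProbLe_ne_ne hP hij (hmono N (Nat.le_succ r))).anti (hstart N r)
    have hb2 : ∀ q ∈ ((Finset.range (N + 1)) ×ˢ (Finset.range (N + 1))).filter
        fun q => q.1 < q.2, CondProbLe μ X a (pairChange X i j (t N q.1) (t N (q.1 + 1)) ∩
          pairChange X i j (t N q.2) (t N (q.2 + 1)))
        ((2 * (L / (N + 1))) * (2 * (L / (N + 1)))) := fun q hq => by
      have h1 := hX.condProbLe_pairChange hP i j (hmono N (Nat.le_succ q.1))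
      have h2 := hX.condProbLe_pairChange hP i j (hmono N (Nat.le_succ q.2))
      rw [Nat.succ_eq_add_one, hstep] at h1 h2
      -- The first cell ends no later than the second begins, so the second bound can be conditioned
      -- on the first change.
      exact ((h1.inter (hmono N (Nat.le_succ q.1)) (by positivity)
        (measurableSet_pairChange X i j (hmono N (Nat.le_succ q.1)))
        (h2.anti (hmono N (Finset.mem_filter.1 hq).2)))).anti (hstart N q.1)
    refine ((CondProbLe.biUnion _ hb1).union (CondProbLe.biUnion _ hb2)).mono subset_rfl ?_
    have hc : ((((Finset.range (N + 1)) ×ˢ (Finset.range (N + 1))).filter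
        fun q => q.1 < q.2).card : ℝ) ≤ ((N : ℝ) + 1) ^ 2 := by
      have := Finset.card_filter_le ((Finset.range (N + 1)) ×ˢ (Finset.range (N + 1)))
        fun q => q.1 < q.2
      rw [Finset.card_product, Finset.card_range, ← sq] at this
      exact_mod_cast this
    have e1 : ((N : ℝ) + 1) * (L / (N + 1)) ^ 2 ≤ L ^ 2 := by
      rw [div_pow, mul_div_assoc', div_le_iff₀ (by positivity)]
      nlinarith [sq_nonneg L, mul_nonneg (sq_nonneg L) (Nat.cast_nonneg (α := ℝ) N)]
    have e2 := mul_le_mul_of_nonneg_right hc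
      (by positivity : 0 ≤ (2 * (L / ((N : ℝ) + 1))) * (2 * (L / (N + 1))))
    have e3 : ((N : ℝ) + 1) ^ 2 * ((2 * (L / ((N : ℝ) + 1))) * (2 * (L / (N + 1)))) =
        4 * L ^ 2 := by
      field_simp
      ring
    rw [Finset.card_range]
    push_cast
    linarith

/-! ### Window events -/

/-- The first window is peeled off: the induction hypothesis is applied at `t + ε` to `A ∩ S`, and
the Markov property then brings the integral back to `t`. -/
theorem IsSingleSiteChain.setIntegral_windowEvent (hX : IsSingleSiteChain μ P X) (i j : Fin n)
    (ε : ℝ≥0) : ∀ (m : ℕ) (l : Fin m → Fin n) (t : ℝ≥0) (A : Set Ω),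
      MeasurableSet[history X t] A →
      ∫ ω in A, (windowEvent X i j ε t l).indicator (fun _ => (1 : ℝ)) ω ∂μ =
        ∫ ω in A, windowProb P i j ε m l (X t ω) ∂μ
  | 0, l, t, A, _ => by
    have : windowEvent X i j ε t l = Set.univ := by
      ext ω
      simp [windowEvent]
    rw [this, Set.indicator_univ]
    rfl
  | m + 1, l, t, A, hA => by
    classical
    have hle : t ≤ t + ε := le_self_add
    set S : Set Ω := {ω | FlipsOnly i j (l 0) (X t ω) (X (t + ε) ω)} with hS
    have hSm : MeasurableSet[history X (t + ε)] S :=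
      measurableSet_history_two X hle le_rfl (FlipsOnly i j (l 0))
    have h1 := hX.setIntegral_windowEvent i j ε m (Fin.tail l) (t + ε) (A ∩ S)
      ((history_mono X hle _ hA).inter hSm)
    rw [windowEvent_succ, ← Set.indicator_indicator]
    rw [← setIntegral_indicator (hX.history_le _ _ hSm),
      ← setIntegral_indicator (hX.history_le _ _ hSm)] at h1
    have h2 (F : Ω → ℝ) : S.indicator F = fun ω =>
        if FlipsOnly i j (l 0) (X t ω) (X (t + ε) ω) then F ω else 0 := by
      funext ω
      simp [Set.indicator_apply, hS]
    have h3 := hX.setIntegral_comp (fun x y =>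
      if FlipsOnly i j (l 0) x y then windowProb P i j ε m (Fin.tail l) y else 0) hle hA
    refine h1.trans ?_
    rw [h2]
    refine h3.trans ?_
    rw [NNReal.coe_add, add_sub_cancel_left]
    rfl

theorem IsSingleSiteChain.condExp_windowEvent (hX : IsSingleSiteChain μ P X) (i j : Fin n)
    (ε t : ℝ≥0) {m : ℕ} (l : Fin m → Fin n) :
    μ[(windowEvent X i j ε t l).indicator (fun _ => (1 : ℝ)) | obs X t] =ᵐ[μ]
      fun ω => windowProb P i j ε m l (X t ω) := by
  refine (ae_eq_condExp_of_forall_setIntegral_eq (hX.obs_le t)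
    ((integrable_const 1).indicator (hX.measurableSet_windowEvent i j ε t l))
    (fun A _ _ => (hX.integrable_comp _ t).integrableOn) (fun A hA _ => ?_) ?_).symm
  · exact (hX.setIntegral_windowEvent i j ε m l t A
      (hX.hasCadlagPaths.obs_le_history t _ hA)).symm
  · exact ((measurable_of_countable _).comp
      (hX.hasCadlagPaths.measurable_obs t)).stronglyMeasurable.aestronglyMeasurable

end FlipCycle

namespace FlipCycle

/-! ### Comparison of flip events and window events -/

section Pathwise

variable {n : ℕ} {Ω : Type*} {X : ℝ≥0 → Ω → Config n}

theorem flipCount_eq_Ioc (X : ℝ≥0 → Ω → Config n) (i : Fin n) {a b : ℝ≥0} {ω : Ω}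
    (ha : a ∉ flipTimes X i ω) :
    flipCount X i a b ω = (jumps (fun u => X u ω i) ∩ Set.Ioc a b).encard := by
  rw [flipCount]
  congr 1
  ext s
  simp only [Set.mem_inter_iff, Set.mem_Icc, Set.mem_Ioc]
  refine ⟨fun h => ⟨h.1, lt_of_le_of_ne h.2.1 fun h0 => ha (h0 ▸ h.1), h.2.2⟩,
    fun h => ⟨h.1, h.2.1.le, h.2.2⟩⟩

theorem HasCadlagPaths.eq_of_encard_eq_zero (hX : HasCadlagPaths X) (i : Fin n) {a b : ℝ≥0}
    (hab : a ≤ b) {ω : Ω} (h : (jumps (fun u => X u ω i) ∩ Set.Ioc a b).encard = 0) :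
    X b ω i = X a ω i :=
  ((hX ω i).eq_of_no_jump hab (Set.encard_eq_zero.1 h)).symm

theorem HasCadlagPaths.ne_of_encard_eq_one (hX : HasCadlagPaths X) (i : Fin n) {a b : ℝ≥0}
    {ω : Ω} (h : (jumps (fun u => X u ω i) ∩ Set.Ioc a b).encard = 1) :
    X b ω i ≠ X a ω i := by
  obtain ⟨s, hs⟩ := Set.encard_eq_one.1 h
  exact ((hX ω i).ne_of_one_jump hs).symm

theorem enat_eq_one_and_eq_zero {a b : ℕ∞} (h : a + b < 2) (ha : a ≠ 0) : a = 1 ∧ b = 0 := by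
  induction a using ENat.recTopCoe with
  | top => simp at h
  | coe a =>
    induction b using ENat.recTopCoe with
    | top => simp at h
    | coe b =>
      norm_cast at h ha ⊢
      omega

/-- In window `r` there are at least two flips of the sites `i` and `j`, and in each of the
other windows one of the two spins changes. -/
def excessEvent (X : ℝ≥0 → Ω → Config n) (i j : Fin n) (ε t : ℝ≥0) (m r : ℕ) : Set Ω :=
  ⋂ k ∈ Finset.range m, if k = r then twoFlips X i j (t + k * ε) (t + ((k + 1 : ℕ) : ℝ≥0) * ε)
    else pairChange X i j (t + k * ε) (t + ((k + 1 : ℕ) : ℝ≥0) * ε)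

theorem HasCadlagPaths.mem_windowEvent_of_flipEvent (hX : HasCadlagPaths X) {i j : Fin n}
    {ε t : ℝ≥0} {m : ℕ} {l : Fin m → Fin n} {ω : Ω}
    (hno : ∀ r : ℕ, t + r * ε ∉ flipTimes X i ω ∧ t + r * ε ∉ flipTimes X j ω)
    (hω : ω ∈ flipEvent X i j ε t l) : ω ∈ windowEvent X i j ε t l := by
  intro r s hs
  have hle : t + ((r : ℕ) : ℝ≥0) * ε ≤ t + (((r : ℕ) : ℝ≥0) + 1) * ε := by
    gcongr
    exact le_self_add
  have h1 := hω r s hs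
  rw [flipCount_eq_Ioc X s (by
    rcases hs with rfl | rfl
    · exact (hno r).1
    · exact (hno r).2)] at h1
  split_ifs at h1 with h
  · exact iff_of_true (hX.ne_of_encard_eq_one s h1) h
  · exact iff_of_false (not_not.2 (hX.eq_of_encard_eq_zero s hle h1)) h

/-- A change over a window forces a flip of `l r`; if the window has fewer than two flips in total,
this is the only one. The hypothesis `hno` handles the end points, where a flip would be counted in
two adjacent closed windows. -/
theorem HasCadlagPaths.mem_flipEvent_or_excess (hX : HasCadlagPaths X) {i j : Fin n}
    {ε t : ℝ≥0} {m : ℕ} {l : Fin m → Fin n} (hl : ∀ r, l r = i ∨ l r = j)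
    {ω : Ω} (hno : ∀ r : ℕ, t + r * ε ∉ flipTimes X i ω ∧ t + r * ε ∉ flipTimes X j ω)
    (hω : ω ∈ windowEvent X i j ε t l) :
    ω ∈ flipEvent X i j ε t l ∨ ω ∈ ⋃ r ∈ Finset.range m, excessEvent X i j ε t m r := by
  by_contra! hcon
  obtain ⟨hE, hV⟩ := hcon
  refine hE fun r => ?_
  have hle : t + ((r : ℕ) : ℝ≥0) * ε ≤ t + (((r : ℕ) : ℝ≥0) + 1) * ε := by
    gcongr
    exact le_self_add
  have htwo : ω ∉ twoFlips X i j (t + (r : ℕ) * ε) (t + ((r : ℕ) + 1) * ε) := by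
    intro htwo
    refine hV (Set.mem_iUnion₂.2 ⟨r, Finset.mem_range.2 r.2, Set.mem_iInter₂.2 fun k hk => ?_⟩)
    split_ifs with hkr
    · rw [hkr]
      push_cast
      exact htwo
    · have hk' := hω ⟨k, Finset.mem_range.1 hk⟩ (l ⟨k, Finset.mem_range.1 hk⟩) (hl _)
      have hne := hk'.2 rfl
      push_cast
      rcases hl ⟨k, Finset.mem_range.1 hk⟩ with h | h
      · rw [h] at hne
        exact Or.inl hne
      · rw [h] at hne
        exact Or.inr hne
  have hlt : (jumps (fun u => X u ω i) ∩
      Set.Ioc (t + (r : ℕ) * ε) (t + ((r : ℕ) + 1) * ε)).encard +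
      (jumps (fun u => X u ω j) ∩
        Set.Ioc (t + (r : ℕ) * ε) (t + ((r : ℕ) + 1) * ε)).encard < 2 := not_le.1 htwo
  have hch : (jumps (fun u => X u ω (l r)) ∩
      Set.Ioc (t + (r : ℕ) * ε) (t + ((r : ℕ) + 1) * ε)).encard ≠ 0 := fun h0 =>
    (hω r (l r) (hl r)).2 rfl (hX.eq_of_encard_eq_zero (l r) hle h0)
  have hcases (s : Fin n) (hs : s = i ∨ s = j) :
      flipCount X s (t + (r : ℕ) * ε) (t + ((r : ℕ) + 1) * ε) ω =
      (jumps (fun u => X u ω s) ∩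
        Set.Ioc (t + (r : ℕ) * ε) (t + ((r : ℕ) + 1) * ε)).encard := flipCount_eq_Ioc X s (by
    rcases hs with rfl | rfl
    · exact (hno r).1
    · exact (hno r).2)
  intro s hs
  rw [hcases s hs]
  by_cases hsl : s = l r
  · rw [if_pos hsl, hsl]
    rcases hl r with h | h <;> rw [h] at hch ⊢
    · exact (enat_eq_one_and_eq_zero hlt hch).1
    · rw [add_comm] at hlt
      exact (enat_eq_one_and_eq_zero hlt hch).1
  · rw [if_neg hsl]
    rcases hl r with h | h <;> rw [h] at hch hsl
    · rw [hs.resolve_left hsl]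
      exact (enat_eq_one_and_eq_zero hlt hch).2
    · rw [hs.resolve_right hsl]
      rw [add_comm] at hlt
      exact (enat_eq_one_and_eq_zero hlt hch).2

end Pathwise

variable {n : ℕ} {Ω : Type*} [MeasurableSpace Ω] {μ : Measure Ω}
  {P : Fin n → Matrix (Config n) (Config n) ℝ} {X : ℝ≥0 → Ω → Config n}

theorem IsSingleSiteChain.measurableSet_flipEvent (hX : IsSingleSiteChain μ P X) (i j : Fin n)
    (ε t : ℝ≥0) {m : ℕ} (l : Fin m → Fin n) : MeasurableSet (flipEvent X i j ε t l) := by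
  have : flipEvent X i j ε t l = ⋂ k : Fin m, ⋂ s : Fin n, ⋂ _ : s = i ∨ s = j,
      flipCount X s (t + (k : ℕ) * ε) (t + ((k : ℕ) + 1) * ε) ⁻¹' {if s = l k then 1 else 0} := by
    ext ω
    simp [flipEvent]
  rw [this]
  exact .iInter fun k => .iInter fun s => .iInter fun _ => hX.history_le _ _
    (hX.hasCadlagPaths.measurable_flipCount s _ _ (measurableSet_singleton _))

variable [IsProbabilityMeasure μ]

/-- Each window contributes a factor `2ε`, except window `r`, whose `5ε² = 2ε · (5/2) ε` supplies
the additional power of `ε`. -/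
theorem IsSingleSiteChain.condProbLe_excess (hX : IsSingleSiteChain μ P X)
    (hP : IsSingleSite P) {i j : Fin n} (hij : i ≠ j) (ε t : ℝ≥0) {m r : ℕ} (hr : r < m) :
    MeasurableSet (excessEvent X i j ε t m r) ∧
      CondProbLe μ X t (excessEvent X i j ε t m r) ((2 * (ε : ℝ)) ^ m * (5 / 2 * ε)) := by
  have hτ : Monotone fun k : ℕ => t + (k : ℝ≥0) * ε := fun a b hab => by
    dsimp only
    gcongr
  have hlen (k : ℕ) : ((t + ((k + 1 : ℕ) : ℝ≥0) * ε : ℝ≥0) : ℝ) - (t + (k : ℝ≥0) * ε : ℝ≥0) =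
      ε := by
    push_cast
    ring
  have hε : (0 : ℝ) ≤ ε := ε.coe_nonneg
  have key := CondProbLe.iInter (μ := μ) (X := X) hτ
    (V := fun k => if k = r then twoFlips X i j (t + k * ε) (t + ((k + 1 : ℕ) : ℝ≥0) * ε)
      else pairChange X i j (t + k * ε) (t + ((k + 1 : ℕ) : ℝ≥0) * ε))
    (q := fun k => 2 * (ε : ℝ) * if k = r then 5 / 2 * (ε : ℝ) else 1)
    (fun k => by positivity) (fun k => by
      split_ifs
      · exact hX.hasCadlagPaths.measurableSet_twoFlips i j (hτ (Nat.le_succ k))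
      · exact measurableSet_pairChange X i j (hτ (Nat.le_succ k))) (fun k => by
      split_ifs
      · refine (hX.condProbLe_twoFlips hP hij (hτ (Nat.le_succ k))).mono subset_rfl ?_
        rw [Nat.succ_eq_add_one, hlen]
        exact le_of_eq (by ring)
      · refine (hX.condProbLe_pairChange hP i j (hτ (Nat.le_succ k))).mono subset_rfl ?_
        rw [Nat.succ_eq_add_one, hlen, mul_one]) m
  have h0 : t + ((0 : ℕ) : ℝ≥0) * ε = t := by simp
  refine ⟨hX.history_le _ _ key.1, ?_⟩
  have h2 := key.2
  rw [h0, Finset.prod_mul_distrib, Finset.prod_const, Finset.card_range,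
    Finset.prod_ite_eq', if_pos (Finset.mem_range.2 hr)] at h2
  exact h2

/-- Almost surely the flip event is contained in the window event, which is contained in the union
of the flip event and the excess events. -/
theorem IsSingleSiteChain.condExp_flipEvent (hX : IsSingleSiteChain μ P X)
    (hP : IsSingleSite P) {i j : Fin n} (hij : i ≠ j) (ε t : ℝ≥0) {m : ℕ} {l : Fin m → Fin n}
    (hl : ∀ r, l r = i ∨ l r = j) :
    ∀ᵐ ω ∂μ, |(μ[(flipEvent X i j ε t l).indicator (fun _ => (1 : ℝ)) | obs X t]) ω -
      windowProb P i j ε m l (X t ω)| ≤ m * ((2 * (ε : ℝ)) ^ m * (5 / 2 * ε)) := by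
  set V : Set Ω := ⋃ r ∈ Finset.range m, excessEvent X i j ε t m r with hV
  have hVm : MeasurableSet V := Finset.measurableSet_biUnion _ fun r hr =>
    (hX.condProbLe_excess hP hij ε t (Finset.mem_range.1 hr)).1
  have hVq : CondProbLe μ X t V (m * ((2 * (ε : ℝ)) ^ m * (5 / 2 * ε))) := by
    have := CondProbLe.biUnion (μ := μ) (X := X) (Finset.range m) fun r hr =>
      (hX.condProbLe_excess hP hij ε t (Finset.mem_range.1 hr)).2
    rwa [Finset.card_range] at this
  set E := (flipEvent X i j ε t l).indicator (fun _ => (1 : ℝ)) with hE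
  set D := (windowEvent X i j ε t l).indicator (fun _ => (1 : ℝ)) with hD
  set G := V.indicator (fun _ => (1 : ℝ)) with hG
  have hEi : Integrable E μ :=
    (integrable_const 1).indicator (hX.measurableSet_flipEvent i j ε t l)
  have hDi : Integrable D μ :=
    (integrable_const 1).indicator (hX.measurableSet_windowEvent i j ε t l)
  have hGi : Integrable G μ := (integrable_const 1).indicator hVm
  have hno : ∀ᵐ ω ∂μ, ∀ r : ℕ, t + r * ε ∉ flipTimes X i ω ∧ t + r * ε ∉ flipTimes X j ω :=
    ae_all_iff.2 fun r => (hX.ae_notMem_flipTimes hP i _).and (hX.ae_notMem_flipTimes hP j _)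
  have hED : E ≤ᵐ[μ] D := by
    filter_upwards [hno] with ω hω
    by_cases h : ω ∈ flipEvent X i j ε t l
    · have h' := hX.hasCadlagPaths.mem_windowEvent_of_flipEvent hω h
      simp [hE, hD, h, h']
    · simp only [hE, hD, Set.indicator_of_notMem h]
      exact Set.indicator_nonneg (fun _ _ => zero_le_one) ω
  have hDE : D ≤ᵐ[μ] E + G := by
    filter_upwards [hno] with ω hω
    have hE0 : 0 ≤ E ω := Set.indicator_nonneg (fun _ _ => zero_le_one) ω
    have hG0 : 0 ≤ G ω := Set.indicator_nonneg (fun _ _ => zero_le_one) ω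
    rw [Pi.add_apply]
    by_cases h : ω ∈ windowEvent X i j ε t l
    · have hD1 : D ω = 1 := Set.indicator_of_mem h _
      rcases hX.hasCadlagPaths.mem_flipEvent_or_excess hl hω h with h' | h'
      · have : E ω = 1 := Set.indicator_of_mem h' _
        linarith
      · have : G ω = 1 := Set.indicator_of_mem h' _
        linarith
    · have hD0 : D ω = 0 := Set.indicator_of_notMem h _
      linarith
  filter_upwards [condExp_mono (m := obs X t) hEi hDi hED,
    condExp_mono (m := obs X t) hDi (hEi.add hGi) hDE, condExp_add hEi hGi (obs X t),
    hX.condExp_windowEvent i j ε t l, hX.condExp_le hVq hVm] with ω h1 h2 h3 h4 h5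
  rw [h3, Pi.add_apply] at h2
  rw [h4] at h1 h2
  have hq : 0 ≤ (m : ℝ) * ((2 * (ε : ℝ)) ^ m * (5 / 2 * ε)) := by positivity
  rw [abs_le]
  constructor <;> linarith

/-! ### Conditional expectation of the cycle statistic -/

theorem IsSingleSiteChain.condExp_cycleStat (hX : IsSingleSiteChain μ P X) (i j : Fin n)
    (ε t : ℝ≥0) :
    μ[cycleStat X i j ε t | obs X t] =ᵐ[μ] fun ω =>
      (μ[(flipEvent X i j ε t ![i, i, j, j, i, i, j, j]).indicator (fun _ => (1 : ℝ)) | obs X t]) ω -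
      2 * (μ[(flipEvent X i j ε t ![i, i, j, j, j, i, i, j]).indicator
        (fun _ => (1 : ℝ)) | obs X t]) ω +
      (μ[(flipEvent X i j ε t ![j, i, i, j, j, i, i, j]).indicator (fun _ => (1 : ℝ)) | obs X t]) ω := by
  have h (l : Fin 8 → Fin n) : Integrable ((flipEvent X i j ε t l).indicator
      fun _ => (1 : ℝ)) μ :=
    (integrable_const 1).indicator (hX.measurableSet_flipEvent i j ε t l)
  have heq : cycleStat X i j ε t =
      (flipEvent X i j ε t ![i, i, j, j, i, i, j, j]).indicator (fun _ => (1 : ℝ)) -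
      (2 : ℝ) • (flipEvent X i j ε t ![i, i, j, j, j, i, i, j]).indicator (fun _ => (1 : ℝ)) +
      (flipEvent X i j ε t ![j, i, i, j, j, i, i, j]).indicator (fun _ => (1 : ℝ)) := rfl
  rw [heq]
  filter_upwards [condExp_add ((h ![i, i, j, j, i, i, j, j]).sub
      ((h ![i, i, j, j, j, i, i, j]).smul (2 : ℝ))) (h ![j, i, i, j, j, i, i, j]) (obs X t),
    condExp_sub (h ![i, i, j, j, i, i, j, j]) ((h ![i, i, j, j, j, i, i, j]).smul (2 : ℝ)) (obs X t),
    condExp_smul (2 : ℝ) ((flipEvent X i j ε t ![i, i, j, j, j, i, i, j]).indicator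
      fun _ => (1 : ℝ)) (obs X t) (μ := μ)] with ω h1 h2 h3
  rw [h1, Pi.add_apply, h2, Pi.sub_apply, h3, Pi.smul_apply, smul_eq_mul]

variable {A : Matrix (Fin n) (Fin n) ℝ} {h : Fin n → ℝ} {d : ℕ} {lam α : ℝ}
  {f : Fin n → ℝ → ℝ} {δ₀ : ℝ} {η : ℝ → ℝ} {γ κ : ℝ}

theorem IsSingleSiteChain.abs_condExp_cycleStat_sub_le (hX : IsSingleSiteChain μ P X)
    (hA : IsingAssumption A h d lam α) (hC : ChainAssumption A h P f lam α δ₀ η γ κ)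
    {i j : Fin n} (hij : i ≠ j) (ε t : ℝ≥0) :
    ∀ᵐ ω ∂μ, |(μ[cycleStat X i j ε t | obs X t]) ω - (ε : ℝ) ^ 8 *
      gfun (f j) (ratio (ising A h) j (X t ω)) ^ 2 * gdiff A h f i j (X t ω) ^ 2| ≤
        20864 * d * (ε : ℝ) ^ 9 := by
  have hP := hC.singleSite
  have hi : i ∈ pairNbhd A i j := by simp [pairNbhd]
  have hj : j ∈ pairNbhd A i j := by simp [pairNbhd]
  have hpi : IsLocal (pairNbhd A i j) (flipProb P i) :=
    hC.bounded.isLocal_flipProb hi fun m hm => by simp [pairNbhd, hm]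
  have hpj : IsLocal (pairNbhd A i j) (flipProb P j) :=
    hC.bounded.isLocal_flipProb hj fun m hm => by simp [pairNbhd, hm]
  have hd : (1 : ℝ) ≤ d := by exact_mod_cast hA.d_pos
  have hε9 : 0 ≤ (ε : ℝ) ^ 9 := by positivity
  have key (l : Fin 8 → Fin n) (hl : ∀ r, l r = i ∨ l r = j) : ∀ᵐ ω ∂μ,
      |(μ[(flipEvent X i j ε t l).indicator (fun _ => (1 : ℝ)) | obs X t]) ω -
        (ε : ℝ) ^ 8 * flipProd P 8 l (X t ω)| ≤ 5216 * d * (ε : ℝ) ^ 9 := by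
    filter_upwards [hX.condExp_flipEvent hP hij ε t hl] with ω h1
    have h2 := hP.windowProb_sub_le hij hi hj (hA.card_pairNbhd_le i j) hpi hpj ε.coe_nonneg 8 l hl
      (X t ω)
    -- The excess events give `8 · 2⁸ · 5/2 = 5120` and the windows `3 · 8 · 4d = 96d`, together at
    -- most `5216d` because `d ≥ 1`.
    refine (abs_sub_le _ _ _).trans ((add_le_add h1 h2).trans ?_)
    push_cast
    nlinarith [mul_nonneg (sub_nonneg.2 hd) hε9]
  filter_upwards [hX.condExp_cycleStat i j ε t,
    key ![i, i, j, j, i, i, j, j] (by simp [Fin.forall_fin_succ]),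
    key ![i, i, j, j, j, i, i, j] (by simp [Fin.forall_fin_succ]),
    key ![j, i, i, j, j, i, i, j] (by simp [Fin.forall_fin_succ])] with ω h0 h1 h2 h3
  rw [h0, mul_assoc, ← flipProd_cycles hC.reversible hC.consistent]
  rw [abs_le] at h1 h2 h3 ⊢
  -- The coefficients `1`, `2`, `1` multiply the error by `4`.
  constructor <;> linarith [h1.1, h1.2, h2.1, h2.2, h3.1, h3.2]

/-- The bound holds given the full history at time `t - 1`, uniformly in the state, and so survives
averaging down to the observations at the earlier time `t'`. -/
theorem IsSingleSiteChain.le_condExp_comp (hX : IsSingleSiteChain μ P X) {φ : Config n → ℝ}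
    {L : ℝ} (hL : ∀ x, L ≤ evol P 1 φ x) {t t' : ℝ≥0} (ht : t' + 1 ≤ t) :
    ∀ᵐ ω ∂μ, L ≤ (μ[fun ω => φ (X t ω) | obs X t']) ω := by
  obtain ⟨s, rfl⟩ : ∃ s, t = s + 1 := ⟨t - 1, (tsub_add_cancel_of_le (le_of_add_le_right ht)).symm⟩
  have hts : t' ≤ s := by simpa using ht
  have hle : obs X t' ≤ history X s :=
    (hX.hasCadlagPaths.obs_le_history t').trans (history_mono X hts)
  have h1 : (fun _ => L) ≤ᵐ[μ] μ[fun ω => φ (X (s + 1) ω) | history X s] := by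
    filter_upwards [hX.condExp_comp φ (le_self_add : s ≤ s + 1)] with ω hω
    rw [hω]
    push_cast
    rw [add_sub_cancel_left]
    exact hL _
  have h2 := condExp_mono (m := obs X t') (integrable_const L) integrable_condExp h1
  filter_upwards [h2, condExp_condExp_of_le (μ := μ) (f := fun ω => φ (X (s + 1) ω)) hle
    (hX.history_le s)] with ω h3 h4
  rw [condExp_const (hX.obs_le t'), h4] at h3
  exact h3

theorem IsSingleSiteChain.abs_condExp_cycleStat_le (hX : IsSingleSiteChain μ P X)
    (hA : IsingAssumption A h d lam α) (hC : ChainAssumption A h P f lam α δ₀ η γ κ)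
    {i j : Fin n} (hij : i ≠ j) (hadj : ¬ Adj A i j) (ε : ℝ≥0) {t t' : ℝ≥0} (ht : t' ≤ t) :
    ∀ᵐ ω ∂μ, |(μ[cycleStat X i j ε t | obs X t']) ω| ≤ 20864 * d * (ε : ℝ) ^ 9 := by
  have h0 := hX.abs_condExp_cycleStat_sub_le hA hC hij ε t
  have hg (x : Config n) : gdiff A h f i j x = 0 := by
    rw [gdiff, ratio_flipAt_of_not_adj hA.symm h hij hadj, sub_self]
  have hlo : (fun _ => -(20864 * d * (ε : ℝ) ^ 9)) ≤ᵐ[μ] μ[cycleStat X i j ε t | obs X t] := by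
    filter_upwards [h0] with ω hω
    rw [hg] at hω
    linarith [(abs_le.1 hω).1]
  have hup : μ[cycleStat X i j ε t | obs X t] ≤ᵐ[μ] fun _ => 20864 * d * (ε : ℝ) ^ 9 := by
    filter_upwards [h0] with ω hω
    rw [hg] at hω
    linarith [(abs_le.1 hω).2]
  filter_upwards [condExp_mono (m := obs X t') (integrable_const _) integrable_condExp hlo,
    condExp_mono (m := obs X t') integrable_condExp (integrable_const _) hup,
    condExp_condExp_of_le (μ := μ) (f := cycleStat X i j ε t) (obs_mono X ht)
      (hX.obs_le t)] with ω h1 h2 h3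
  rw [condExp_const (hX.obs_le t'), h3] at h1
  rw [condExp_const (hX.obs_le t'), h3] at h2
  exact abs_le.2 ⟨h1, h2⟩

open Classical in
theorem IsSingleSiteChain.le_condExp_cycleStat (hX : IsSingleSiteChain μ P X)
    (hA : IsingAssumption A h d lam α) (hC : ChainAssumption A h P f lam α δ₀ η γ κ)
    {i j k : Fin n} (hij : Adj A i j) (hik : Adj A i k) (hkj : k ≠ j) (ε : ℝ≥0) {δ : ℝ}
    (hδ0 : 0 < δ) (hδ1 : δ ≤ 1) (hδ : δ ≤ δ₀) (hη : η δ ≤ α * Real.exp (-(2 * lam)))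
    {t t' : ℝ≥0} (ht : t' + 1 ≤ t) :
    ∀ᵐ ω ∂μ, (ε : ℝ) ^ 8 * κ ^ 4 * δ ^ 2 *
      (Real.exp (-1) / 2 * κ * Real.exp (-(2 * γ * lam))) - 20864 * d * (ε : ℝ) ^ 9 ≤
        (μ[cycleStat X i j ε t | obs X t']) ω := by
  have hP := hC.singleSite
  have hκ := hC.κ_pos
  -- The indicator of the good configurations. By stability it satisfies the hypothesis of
  -- `evol_one_ge` at the further neighbour `k`.
  set φ : Config n → ℝ := fun x => if δ < |gdiff A h f i j x| then 1 else 0 with hφ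
  have hφ01 (x : Config n) : 0 ≤ φ x ∧ φ x ≤ 1 := by
    simp only [hφ]
    split_ifs <;> norm_num
  have hφk (x : Config n) : 1 ≤ φ x + φ (flipAt x k) := by
    rcases lt_abs_gdiff_or hA hC.stable hij hik hkj hδ0 hδ1 hδ hη x with h1 | h1
    · have : φ x = 1 := if_pos h1
      linarith [(hφ01 (flipAt x k)).1]
    · have : φ (flipAt x k) = 1 := if_pos h1
      linarith [(hφ01 x).1]
  have hL := evol_one_ge hA hP hC.bounded hC.γ_nonneg hκ.le (hC.flip_ge k)
    (fun x => (hφ01 x).1) (fun x => (hφ01 x).2) hφk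
  have hmain (x : Config n) : (ε : ℝ) ^ 8 * κ ^ 4 * δ ^ 2 * φ x ≤ (ε : ℝ) ^ 8 *
      gfun (f j) (ratio (ising A h) j x) ^ 2 * gdiff A h f i j x ^ 2 := by
    -- A value of `g_j` at a ratio is a product of two flip probabilities, each at least `κ`.
    have hg : κ ^ 2 ≤ gfun (f j) (ratio (ising A h) j x) := by
      rw [gfun_ratio hC.reversible hC.consistent, sq]
      exact mul_le_mul (hC.flip_ge j x) (hC.flip_ge j _) hκ.le (hP.flipProb_nonneg j x)
    have hg2 : κ ^ 4 ≤ gfun (f j) (ratio (ising A h) j x) ^ 2 := by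
      calc κ ^ 4 = (κ ^ 2) ^ 2 := by ring
        _ ≤ _ := by gcongr
    by_cases hx : δ < |gdiff A h f i j x|
    · have h1 : φ x = 1 := if_pos hx
      have h2 : δ ^ 2 ≤ gdiff A h f i j x ^ 2 := by
        rw [← sq_abs (gdiff A h f i j x)]
        gcongr
      rw [h1, mul_one]
      gcongr
    · have h1 : φ x = 0 := if_neg hx
      rw [h1, mul_zero]
      positivity
  set B : ℝ := (ε : ℝ) ^ 8 * κ ^ 4 * δ ^ 2 with hB
  have hB0 : 0 ≤ B := by positivity
  have hφi := hX.integrable_comp φ t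
  have hlo : (B • fun ω => φ (X t ω)) - (fun _ => 20864 * d * (ε : ℝ) ^ 9) ≤ᵐ[μ]
      μ[cycleStat X i j ε t | obs X t] := by
    filter_upwards [hX.abs_condExp_cycleStat_sub_le hA hC hij.1 ε t] with ω hω
    rw [Pi.sub_apply, Pi.smul_apply, smul_eq_mul]
    linarith [(abs_le.1 hω).1, hmain (X t ω)]
  have ht' : t' ≤ t := le_self_add.trans ht
  filter_upwards [condExp_mono (m := obs X t') ((hφi.smul B).sub (integrable_const _))
      integrable_condExp hlo,
    condExp_sub (hφi.smul B) (integrable_const (20864 * d * (ε : ℝ) ^ 9)) (obs X t'),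
    condExp_smul B (fun ω => φ (X t ω)) (obs X t') (μ := μ),
    condExp_condExp_of_le (μ := μ) (f := cycleStat X i j ε t) (obs_mono X ht') (hX.obs_le t),
    hX.le_condExp_comp hL ht] with ω h1 h2 h3 h4 h5
  rw [h2, Pi.sub_apply, h3, Pi.smul_apply, smul_eq_mul, condExp_const (hX.obs_le t'), h4] at h1
  exact le_trans (sub_le_sub_right (mul_le_mul_of_nonneg_left h5 hB0) _) h1

end FlipCycle

/-! ### Choice of the absolute constants -/

theorem mainTheorem5 :
    ∃ c C : ℝ, 0 < c ∧ 0 < C ∧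
      ∀ (n : ℕ) (A : Matrix (Fin n) (Fin n) ℝ) (h : Fin n → ℝ) (d : ℕ) (lam α : ℝ)
        (P : Fin n → Matrix (FlipCycle.Config n) (FlipCycle.Config n) ℝ)
        (f : Fin n → ℝ → ℝ) (δ₀ : ℝ) (η : ℝ → ℝ) (γ κ : ℝ)
        (Ω : Type*) [MeasurableSpace Ω] (μ : Measure Ω) [IsProbabilityMeasure μ]
        (X : ℝ≥0 → Ω → FlipCycle.Config n),
        FlipCycle.IsingAssumption A h d lam α →
        FlipCycle.ChainAssumption A h P f lam α δ₀ η γ κ →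
        FlipCycle.IsSingleSiteChain μ P X →
        ∀ i j : Fin n, i ≠ j → ∀ ε : ℝ≥0, 0 < ε →
          -- the conditional expectation at the current time
          ((ε : ℝ) < c → ∀ t : ℝ≥0, ∀ᵐ ω ∂μ,
            |(μ[FlipCycle.cycleStat X i j ε t | FlipCycle.obs X t]) ω -
                (ε : ℝ) ^ 8 *
                  FlipCycle.gfun (f j) (FlipCycle.ratio (FlipCycle.ising A h) j (X t ω)) ^ 2 *
                  (FlipCycle.gfun (f i) (FlipCycle.ratio (FlipCycle.ising A h) i (X t ω)) -
                    FlipCycle.gfun (f i) (FlipCycle.ratio (FlipCycle.ising A h) i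
                      (FlipCycle.flipAt (X t ω) j))) ^ 2|
              ≤ C * d * (ε : ℝ) ^ 9) ∧
          -- non-neighbours
          (¬ FlipCycle.Adj A i j → (ε : ℝ) < c → ∀ t t' : ℝ≥0, t' ≤ t → ∀ᵐ ω ∂μ,
            |(μ[FlipCycle.cycleStat X i j ε t | FlipCycle.obs X t']) ω| ≤ C * d * (ε : ℝ) ^ 9) ∧
          -- neighbours `i`, `j` such that `i` has a further neighbour `k`
          (FlipCycle.Adj A i j → (∃ k, k ≠ j ∧ FlipCycle.Adj A i k) →
            ∀ δ : ℝ, 0 < δ → δ ≤ 1 → δ ≤ δ₀ → η δ ≤ c * α * Real.exp (-(C * lam)) →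
            (ε : ℝ) < c * κ ^ 8 * δ ^ 2 * Real.exp (-(C * γ * lam)) / d →
            ∀ t t' : ℝ≥0, t' + 1 ≤ t → ∀ᵐ ω ∂μ,
              c * (ε : ℝ) ^ 8 * κ ^ 8 * δ ^ 2 * Real.exp (-(C * γ * lam)) ≤
                (μ[FlipCycle.cycleStat X i j ε t | FlipCycle.obs X t']) ω) := by
  -- `C` is the error constant `4 · 5216`, far more than the exponents in (c) require. `c` is chosen
  -- so that `20864 c < 1/8`, which makes the error in (c) smaller than the main term.
  refine ⟨1 / 200000, 20864, by norm_num, by norm_num, ?_⟩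
  intro n A h d lam α P f δ₀ η γ κ Ω _ μ _ X hA hC hX i j hij ε _
  refine ⟨fun _ t => hX.abs_condExp_cycleStat_sub_le hA hC hij ε t,
    fun hadj _ t t' ht => hX.abs_condExp_cycleStat_le hA hC hij hadj ε ht, ?_⟩
  rintro hadj ⟨k, hkj, hik⟩ δ hδ0 hδ1 hδ hη hε t t' ht
  have hα := hA.α_pos
  have hlam := hA.lam_pos
  have hγ := hC.γ_nonneg
  have hκ := hC.κ_pos
  have hκ1 : κ ≤ 1 :=
    (hC.flip_ge i fun _ => 1).trans (hC.singleSite.flipProb_le_one i fun _ => 1)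
  have hd : (0 : ℝ) < d := by exact_mod_cast hA.d_pos
  have hη' : η δ ≤ α * Real.exp (-(2 * lam)) := by
    have h1 : Real.exp (-(20864 * lam)) ≤ Real.exp (-(2 * lam)) :=
      Real.exp_le_exp.2 (by linarith)
    refine hη.trans ?_
    calc 1 / 200000 * α * Real.exp (-(20864 * lam)) ≤ 1 * α * Real.exp (-(2 * lam)) := by
          gcongr
          norm_num
      _ = _ := by rw [one_mul]
  filter_upwards [hX.le_condExp_cycleStat hA hC hadj hik hkj ε hδ0 hδ1 hδ hη' ht] with ω hω
  refine le_trans ?_ hω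
  set e := Real.exp (-(20864 * γ * lam)) with he
  have hγl : 0 ≤ γ * lam := mul_nonneg hγ hlam.le
  have h1 : e ≤ Real.exp (-(2 * γ * lam)) := Real.exp_le_exp.2 (by nlinarith)
  -- The argument gives the better power `κ⁵`: four factors from `g_j²` and one from the flip at
  -- `k`.
  have h2 : κ ^ 8 ≤ κ ^ 5 := pow_le_pow_of_le_one hκ.le hκ1 (by norm_num)
  have h3 : (1 / 4 : ℝ) ≤ Real.exp (-1) := by
    rw [Real.exp_neg, one_div]
    exact inv_anti₀ (Real.exp_pos 1) (Real.exp_one_lt_three.le.trans (by norm_num))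
  rw [lt_div_iff₀ hd] at hε
  have hε8 : 0 ≤ (ε : ℝ) ^ 8 := by positivity
  have h4 : 20864 * d * (ε : ℝ) ^ 9 ≤
      20864 * ((ε : ℝ) ^ 8 * (1 / 200000 * κ ^ 8 * δ ^ 2 * e)) := by
    have := mul_le_mul_of_nonneg_left hε.le hε8
    linarith
  have h5 : 1 / 4 / 2 * ((ε : ℝ) ^ 8 * (κ ^ 8 * δ ^ 2 * e)) ≤ (ε : ℝ) ^ 8 * κ ^ 4 * δ ^ 2 *
      (Real.exp (-1) / 2 * κ * Real.exp (-(2 * γ * lam))) := by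
    calc 1 / 4 / 2 * ((ε : ℝ) ^ 8 * (κ ^ 8 * δ ^ 2 * e))
        ≤ (Real.exp (-1) / 2) * ((ε : ℝ) ^ 8 *
          (κ ^ 5 * δ ^ 2 * Real.exp (-(2 * γ * lam)))) := by
          gcongr
      _ = _ := by ring
  have h6 : 0 ≤ (ε : ℝ) ^ 8 * (κ ^ 8 * δ ^ 2 * e) := by positivity
  -- What is left is the coefficient `1/8 - 20864/200000 > 1/200000`.
  linarith
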